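/- Let $m,n\in\mathbb N$ with $M:=m-2n>0$. Let $\Lambda_{2n}$ be the complex Grassmann algebra with anticommuting generators $\grave x_1,\dots,\grave x_{2n}$ and $\mathcal P=\mathbb C[x_1,\dots,x_m]\otimes\Lambda_{2n}$. Put $$r^2=\sum_{i}x_i^2,\quad \theta^2=-\sum_{j=1}^n\grave x_{2j-1}\grave x_{2j},\quad R^2=r^2+\theta^2,$$ $$\nabla_f^2=-4\sum_{j=1}^n\partial_{\grave x_{2j-1}}\partial_{\grave x_{2j}},\quad \nabla^2=\sum_i\partial_{x_i}^2+\nabla_f^2,\quad \mathbb E=\sum_i x_i\partial_{x_i}+\sum_j\grave x_j\partial_{\grave x_j},$$ where $\partial_{\grave x_j}$ are left derivatives. Let $\exp(-R^2/2)=\exp(-r^2/2)\sum_{j=0}^n\frac{(-1)^j\theta^{2j}}{2^jj!}$ and $$\int_{\mathbb R^{m|2n}}f=\int_{\mathbb R^m}\pi^{-n}\,\partial_{\grave x_{2n}}\cdots\partial_{\grave x_1}f\;dV .$$ Let $\mathcal H^b_p$ be the space of homogeneous harmonic polynomials of degree $p$ in $\mathbb C[x_1,\dots,x_m]$, and $\mathcal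 H^f_q$ the space of homogeneous elements of degree $q$ of $\Lambda_{2n}$ killed by $\nabla^2_f$. For $i+q\le n$ let $$f_{i,p,q}=\sum_{s=0}^i\binom is\frac{(n-q-s)!}{\Gamma(\frac m2+p+i-s)}\frac{\Gamma(\frac m2+p+i)}{(n-q-i)!}\,r^{2i-2s}\theta^{2s}.$$ Let $a\mapsto\tilde a$ be the linear map on $\Lambda_{2n}$ with $\tilde{\grave x}_{2j-1}=\grave x_{2j}$, $\tilde{\grave x}_{2j}=-\grave x_{2j-1}$ and $\widetilde{ab}=\tilde b\tilde a$. Then there is exactly one linear map $T$ on $\mathcal P\exp(-R^2/2)$ such that $$T\big(R^{2j}f_{i,p,q}H^bH^f\exp(-R^2/2)\big)=(-1)^iR^{2j}f_{i,p,q}H^b\widetilde{H^f}\exp(-R^2/2)$$ for all $j,i,p,q\in\mathbb N$ with $i+q\le n$, $H^b\in\mathcal H^b_p$ and $H^f\in\mathcal H^f_q$. Put $$\langle f|g\rangle_2=\int_{\mathbb R^{m|2n}}f\,\overline{T(g)},\qquad f,g\in\mathcal P\exp(-R^2/2),$$ where the bar is complex conjugation of the coefficient functions, and write $A^\dagger=B$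 if $A$ and $B$ map $\mathcal P\exp(-R^2/2)$ to itself and $\langle Af|g\rangle_2=\langle f|Bg\rangle_2$ for all $f,g$ in it. Then $$(R^2)^\dagger=R^2,\qquad(\nabla^2)^\dagger=\nabla^2,\qquad(2\mathbb E+M)^\dagger=-(2\mathbb E+M).$$ Moreover, for every polynomial $V$ with real coefficients, the Schrödinger operator $-\nabla^2/2+V(R^2)$ is symmetric: $(-\nabla^2/2+V(R^2))^\dagger=-\nabla^2/2+V(R^2)$. -/

import Mathlib

open scoped TensorProduct ContDiff

noncomputable section

namespace SuperSpace

/-! ### The Grassmann algebra with `2n` generators -/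

/-- The complex Grassmann algebra on `2n` generators. -/
abbrev Grassmann (n : ℕ) : Type := ExteriorAlgebra ℂ (Fin (2 * n) → ℂ)

/-- The `k`-th anticommuting generator. With indices counted from `0`, the generators
`x̀_{2j-1}, x̀_{2j}` of the usual numbering, `j = 1, …, n`, are `gen (odd j)` and `gen (even j)`
for `j : Fin n`. -/
def gen {n : ℕ} (k : Fin (2 * n)) : Grassmann n := ExteriorAlgebra.ι ℂ (Pi.single k 1)

def odd {n : ℕ} (j : Fin n) : Fin (2 * n) := ⟨2 * j, by omega⟩

def even {n : ℕ} (j : Fin n) : Fin (2 * n) := ⟨2 * j + 1, by omega⟩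

/-- The left derivative `∂_{x̀_k}`: it kills scalars and satisfies
`∂_k (v * f) = (v)_k • f - v * ∂_k f` for `v` in the span of the generators. -/
def gDeriv {n : ℕ} (k : Fin (2 * n)) : Module.End ℂ (Grassmann n) :=
  CliffordAlgebra.contractLeft (LinearMap.proj k)

/-- `θ² = -∑ x̀_{2j-1} x̀_{2j}`. -/
def theta2 (n : ℕ) : Grassmann n := -∑ j : Fin n, gen (odd j) * gen (even j)

/-- The fermionic Laplace operator `-4 ∑ ∂_{2j-1} ∂_{2j}`. -/
def lapF (n : ℕ) : Module.End ℂ (Grassmann n) :=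
  (-4 : ℂ) • ∑ j : Fin n, gDeriv (odd j) * gDeriv (even j)

/-- The fermionic Euler operator `∑ x̀_k ∂_k`. -/
def eulerF (n : ℕ) : Module.End ℂ (Grassmann n) :=
  ∑ k : Fin (2 * n), LinearMap.mulLeft ℂ (gen k) * gDeriv k

/-- The Berezin integral `π^{-n} ∂_{2n} ⋯ ∂_1`, read as a complex number. -/
def berezin (n : ℕ) : Grassmann n →ₗ[ℂ] ℂ :=
  (((Real.pi : ℂ) ^ n)⁻¹) •
    (ExteriorAlgebra.algebraMapInv.toLinearMap ∘ₗ
      (List.ofFn (fun k : Fin (2 * n) => gDeriv k)).reverse.prod)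

/-- The Grassmann algebra as a ring, made a complex algebra in which `c` acts as its conjugate. -/
def ConjGrassmann (n : ℕ) : Type := Grassmann n

instance (n : ℕ) : Ring (ConjGrassmann n) := inferInstanceAs (Ring (Grassmann n))

instance (n : ℕ) : Algebra ℂ (ConjGrassmann n) :=
  ((algebraMap ℂ (Grassmann n)).comp (starRingEnd ℂ)).toAlgebra'
    (fun c x => Algebra.commutes (A := Grassmann n) (starRingEnd ℂ c) x)

/-- `v ↦ ι (conj v)`, a linear map into the conjugate algebra. -/
def conjGen (n : ℕ) : (Fin (2 * n) → ℂ) →ₗ[ℂ] ConjGrassmann n where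
  toFun v := (ExteriorAlgebra.ι ℂ (fun k => starRingEnd ℂ (v k)) : Grassmann n)
  map_add' v w := by
    have h : (fun k => starRingEnd ℂ ((v + w) k))
        = (fun k => starRingEnd ℂ (v k)) + (fun k => starRingEnd ℂ (w k)) := by
      funext k
      simp
    rw [h, map_add]
    rfl
  map_smul' c v := by
    have h : (fun k => starRingEnd ℂ ((c • v) k))
        = (starRingEnd ℂ c) • (fun k => starRingEnd ℂ (v k)) := by
      funext k
      simp
    rw [h, map_smul, Algebra.smul_def]
    rfl

/-- Complex conjugation on the Grassmann algebra as a complex algebra homomorphism into the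
conjugate algebra: on the generators it is `ι v ↦ ι (conj v)`. -/
def gConjHom (n : ℕ) : Grassmann n →ₐ[ℂ] ConjGrassmann n :=
  ExteriorAlgebra.lift ℂ ⟨conjGen n, fun v =>
    ExteriorAlgebra.ι_sq_zero (R := ℂ) (fun k => starRingEnd ℂ (v k))⟩

/-- Complex conjugation `∑ f_A x̀_A ↦ ∑ conj f_A x̀_A`. -/
def gConj (n : ℕ) : Grassmann n →ₛₗ[starRingEnd ℂ] Grassmann n where
  toFun x := (gConjHom n x : ConjGrassmann n)
  map_add' x y := map_add (gConjHom n) x y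
  map_smul' c x :=
    (map_smul (gConjHom n) c x).trans <|
      (Algebra.smul_def (A := ConjGrassmann n) c (gConjHom n x)).trans
        (Algebra.smul_def (A := Grassmann n) (starRingEnd ℂ c) (gConjHom n x)).symm

theorem gConj_gen {n : ℕ} (k : Fin (2 * n)) : gConj n (gen k) = gen k := by
  have h : gConj n (gen k)
      = ExteriorAlgebra.ι ℂ (fun l => starRingEnd ℂ ((Pi.single k 1 : Fin (2 * n) → ℂ) l)) :=
    ExteriorAlgebra.lift_ι_apply ℂ (conjGen n) _ (Pi.single k 1)
  rw [h, gen]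
  congr 1
  funext l
  by_cases hl : l = k
  · subst hl
    simp
  · simp [Pi.single_eq_of_ne hl]

theorem gConj_one (n : ℕ) : gConj n 1 = 1 := map_one (gConjHom n)

theorem gConj_mul {n : ℕ} (x y : Grassmann n) : gConj n (x * y) = gConj n x * gConj n y :=
  map_mul (gConjHom n) x y

/-- The linear map on generators `x̀_{2j-1} ↦ x̀_{2j}`, `x̀_{2j} ↦ -x̀_{2j-1}`. -/
def genTwist (n : ℕ) : (Fin (2 * n) → ℂ) →ₗ[ℂ] (Fin (2 * n) → ℂ) :=
  ∑ j : Fin n,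
    ((LinearMap.proj (odd j) : (Fin (2 * n) → ℂ) →ₗ[ℂ] ℂ).smulRight (Pi.single (even j) 1)
      - (LinearMap.proj (even j) : (Fin (2 * n) → ℂ) →ₗ[ℂ] ℂ).smulRight (Pi.single (odd j) 1))

/-- The linear map `f ↦ f̃` with `x̀_{2j-1} ↦ x̀_{2j}`, `x̀_{2j} ↦ -x̀_{2j-1}` and
`(a b)~ = b̃ ã`. -/
def tilde (n : ℕ) : Grassmann n →ₗ[ℂ] Grassmann n :=
  CliffordAlgebra.reverse ∘ₗ (ExteriorAlgebra.map (genTwist n)).toLinearMap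

/-- Fermionic spherical harmonics of degree `q`. -/
def harmonicF (n q : ℕ) : Submodule ℂ (Grassmann n) :=
  (⋀[ℂ]^q (Fin (2 * n) → ℂ)) ⊓ LinearMap.ker (lapF n)

/-- The fermionic Gaussian `exp(-θ²/2)`, a finite Taylor sum. -/
def gaussF (n : ℕ) : Grassmann n :=
  ∑ j ∈ Finset.range (n + 1), ((-1 : ℂ) ^ j / (2 ^ j * (j.factorial : ℂ))) • theta2 n ^ j

/-! ### Smooth functions of the commuting variables -/

/-- The algebra of smooth complex functions on `ℝ^m`. -/
def smooth (m : ℕ) : Subalgebra ℂ (EuclideanSpace ℝ (Fin m) → ℂ) where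
  carrier := {f | ContDiff ℝ ∞ f}
  mul_mem' {f g} (hf : ContDiff ℝ ∞ f) (hg : ContDiff ℝ ∞ g) :=
    (hf.mul hg : ContDiff ℝ ∞ (f * g))
  add_mem' {f g} (hf : ContDiff ℝ ∞ f) (hg : ContDiff ℝ ∞ g) :=
    (hf.add hg : ContDiff ℝ ∞ (f + g))
  algebraMap_mem' c := (contDiff_const : ContDiff ℝ ∞ fun _ => c)

/-- The coordinate function `x_i`. -/
def coord {m : ℕ} (i : Fin m) : smooth m :=
  ⟨fun x => ((x i : ℝ) : ℂ), by
    change ContDiff ℝ ∞ _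
    exact Complex.ofRealCLM.contDiff.comp (EuclideanSpace.proj (𝕜 := ℝ) i).contDiff⟩

/-- The bosonic Gaussian `exp(-r²/2)`. -/
def gaussB (m : ℕ) : smooth m :=
  ⟨fun x => ((Real.exp (-(∑ i, x i ^ 2) / 2) : ℝ) : ℂ), by
    change ContDiff ℝ ∞ _
    refine Complex.ofRealCLM.contDiff.comp (Real.contDiff_exp.comp (ContDiff.div_const
      (ContDiff.neg (ContDiff.sum fun i _ => ?_)) _))
    exact (EuclideanSpace.proj (𝕜 := ℝ) i).contDiff.pow 2⟩

/-- The partial derivative `∂_{x_i}` on smooth functions. -/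
def bDeriv {m : ℕ} (i : Fin m) : Module.End ℂ (smooth m) where
  toFun f := ⟨fun x => fderiv ℝ f.1 x (EuclideanSpace.single i 1), by
    have h : ContDiff ℝ ∞ f.1 := f.2
    change ContDiff ℝ ∞ _
    exact (h.fderiv_right (m := ∞) (by simp)).clm_apply contDiff_const⟩
  map_add' f g := by
    have hf : ContDiff ℝ ∞ f.1 := f.2
    have hg : ContDiff ℝ ∞ g.1 := g.2
    ext x
    change fderiv ℝ (f.1 + g.1) x _ = fderiv ℝ f.1 x _ + fderiv ℝ g.1 x _
    rw [fderiv_add (hf.differentiable (by simp) x) (hg.differentiable (by simp) x)]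
    rfl
  map_smul' c f := by
    have hf : ContDiff ℝ ∞ f.1 := f.2
    ext x
    change fderiv ℝ (c • f.1) x _ = c • fderiv ℝ f.1 x _
    rw [fderiv_const_smul (hf.differentiable (by simp) x)]
    rfl

/-- Pointwise complex conjugation of smooth functions. -/
def bConj (m : ℕ) : smooth m →ₛₗ[starRingEnd ℂ] smooth m where
  toFun f := ⟨fun x => starRingEnd ℂ (f.1 x), by
    have h : ContDiff ℝ ∞ f.1 := f.2
    change ContDiff ℝ ∞ _
    exact Complex.conjCLE.contDiff.comp h⟩
  map_add' f g := by
    ext x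
    exact map_add (starRingEnd ℂ) (f.1 x) (g.1 x)
  map_smul' c f := by
    ext x
    exact map_mul (starRingEnd ℂ) c (f.1 x)

/-- Bosonic spherical harmonics of degree `p`: homogeneous harmonic polynomials. -/
def harmonicB (m p : ℕ) : Submodule ℂ (MvPolynomial (Fin m) ℂ) :=
  MvPolynomial.homogeneousSubmodule (Fin m) ℂ p ⊓
    LinearMap.ker (∑ i : Fin m, (MvPolynomial.pderiv i).toLinearMap ∘ₗ
      (MvPolynomial.pderiv i).toLinearMap)

/-! ### Superfunctions -/

/-- Smooth superfunctions on `ℝ^{m|2n}`: `C^∞(ℝ^m) ⊗ Λ_{2n}`. -/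
abbrev SuperFun (m n : ℕ) : Type := smooth m ⊗[ℂ] Grassmann n

instance (m n : ℕ) : Ring (SuperFun m n) := Algebra.TensorProduct.instRing

instance (m n : ℕ) : AddCommGroup (SuperFun m n) := TensorProduct.addCommGroup

/-- Superpolynomials: `ℂ[x_1, …, x_m] ⊗ Λ_{2n}`. -/
abbrev SuperPoly (m n : ℕ) : Type := MvPolynomial (Fin m) ℂ ⊗[ℂ] Grassmann n

instance (m n : ℕ) : Ring (SuperPoly m n) := Algebra.TensorProduct.instRing

instance (m n : ℕ) : AddCommGroup (SuperPoly m n) := TensorProduct.addCommGroup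

/-- Superpolynomials as superfunctions. -/
def polyFun (m n : ℕ) : SuperPoly m n →ₐ[ℂ] SuperFun m n :=
  Algebra.TensorProduct.map (MvPolynomial.aeval (coord (m := m))) (AlgHom.id ℂ (Grassmann n))

/-- `r²` as a superpolynomial. -/
def r2 (m n : ℕ) : SuperPoly m n := (∑ i : Fin m, MvPolynomial.X i ^ 2) ⊗ₜ 1

/-- `θ²` as a superpolynomial. -/
def th2 (m n : ℕ) : SuperPoly m n := 1 ⊗ₜ theta2 n

/-- `R² = r² + θ²`. -/
def R2 (m n : ℕ) : SuperPoly m n := r2 m n + th2 m n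

/-- Multiplication by `R²` on superfunctions. -/
def mulR2 (m n : ℕ) : Module.End ℂ (SuperFun m n) :=
  LinearMap.mulLeft ℂ (polyFun m n (R2 m n))

/-- The super Laplace operator `∇² = ∑ ∂_{x_i}² - 4 ∑ ∂_{x̀_{2j-1}} ∂_{x̀_{2j}}`. -/
def lap (m n : ℕ) : Module.End ℂ (SuperFun m n) :=
  LinearMap.rTensor (Grassmann n) (∑ i : Fin m, bDeriv i * bDeriv i)
    + LinearMap.lTensor (smooth m) (lapF n)

/-- The super Euler operator. -/
def euler (m n : ℕ) : Module.End ℂ (SuperFun m n) :=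
  LinearMap.rTensor (Grassmann n) (∑ i : Fin m, LinearMap.mulLeft ℂ (coord i) * bDeriv i)
    + LinearMap.lTensor (smooth m) (eulerF n)

/-- The super-dimension `M = m - 2n`. -/
def superDim (m n : ℕ) : ℤ := (m : ℤ) - 2 * (n : ℤ)

/-- The operator `2𝔼 + M`. -/
def eulerShift (m n : ℕ) : Module.End ℂ (SuperFun m n) :=
  (2 : ℂ) • euler m n + ((superDim m n : ℤ) : ℂ) • 1

/-- The Schrödinger operator `-∇²/2 + V(R²)` with a real polynomial `V`. -/
def schrodinger (m n : ℕ) (V : Polynomial ℝ) : Module.End ℂ (SuperFun m n) :=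
  (-(1 / 2) : ℂ) • lap m n
    + Polynomial.aeval (mulR2 m n) (V.map (algebraMap ℝ ℂ))

/-- The integral over `ℝ^{m|2n}`: the Berezin integral followed by the Lebesgue integral. -/
def superInt {m n : ℕ} (f : SuperFun m n) : ℂ :=
  ∫ x : EuclideanSpace ℝ (Fin m),
    (TensorProduct.rid ℂ (smooth m) (LinearMap.lTensor (smooth m) (berezin n) f)).1 x

/-- Complex conjugation of superfunctions. -/
def superConj (m n : ℕ) : SuperFun m n →ₛₗ[starRingEnd ℂ] SuperFun m n :=
  TensorProduct.map (bConj m) (gConj n)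

/-- `P ↦ P exp(-R²/2)`, where `exp(-R²/2) = exp(-r²/2) exp(-θ²/2)`. -/
def mulGauss (m n : ℕ) : SuperPoly m n →ₗ[ℂ] SuperFun m n :=
  LinearMap.mulRight ℂ (gaussB m ⊗ₜ gaussF n) ∘ₗ (polyFun m n).toLinearMap

/-- The space `𝒫 exp(-R²/2)`. -/
def polyGauss (m n : ℕ) : Submodule ℂ (SuperFun m n) := LinearMap.range (mulGauss m n)

/-! ### The map `T` and the inner product -/

/-- The polynomial `f_{k,p,q}(r²,θ²) = ∑_{s ≤ k} a_s r^{2k-2s} θ^{2s}`, for `k ≤ n - q`, with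
`a_s = binom(k,s) ((n-q-s)! / Γ(m/2+p+k-s)) (Γ(m/2+p+k) / (n-q-k)!)`. -/
def fPoly (m n k p q : ℕ) : SuperPoly m n :=
  ∑ s ∈ Finset.range (k + 1),
    (((k.choose s : ℝ) * (((n - q - s).factorial : ℝ) / Real.Gamma ((m : ℝ) / 2 + p + k - s))
        * (Real.Gamma ((m : ℝ) / 2 + p + k) / ((n - q - k).factorial : ℝ)) : ℝ) : ℂ)
      • (r2 m n ^ (k - s) * th2 m n ^ s)

/-- `T` is the linear map on `𝒫 exp(-R²/2)` given on the pieces of the Fischer decomposition by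
`T(R^{2j} f_{i,p,q} H^b_p H^f_q exp(-R²/2)) = (-1)^i R^{2j} f_{i,p,q} H^b_p H̃^f_q exp(-R²/2)`. -/
def IsTwist (m n : ℕ) (T : polyGauss m n →ₗ[ℂ] polyGauss m n) : Prop :=
  ∀ j i p q : ℕ, i + q ≤ n → ∀ h ∈ harmonicB m p, ∀ w ∈ harmonicF n q,
    T ((mulGauss m n).rangeRestrict (R2 m n ^ j * fPoly m n i p q * (h ⊗ₜ w)))
      = (mulGauss m n).rangeRestrict
          ((-1 : ℂ) ^ i • (R2 m n ^ j * fPoly m n i p q * (h ⊗ₜ tilde n w)))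

/-- The map `T` on `𝒫 exp(-R²/2)`; for `M > 0` it is the unique map satisfying `IsTwist`. -/
def twist (m n : ℕ) : polyGauss m n →ₗ[ℂ] polyGauss m n :=
  Classical.epsilon (IsTwist m n)

/-- `⟨f|g⟩₂ = ∫_{ℝ^{m|2n}} f conj(T(g))` on `𝒫 exp(-R²/2)`. -/
def inner2 {m n : ℕ} (f g : polyGauss m n) : ℂ :=
  superInt ((f : SuperFun m n) * superConj m n (twist m n g : SuperFun m n))

/-- `A† = B` on `𝒫 exp(-R²/2)`: both operators preserve this space, and
`⟨A f|g⟩₂ = ⟨f|B g⟩₂` for all `f`, `g` in it. -/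
def IsAdjoint {m n : ℕ} (A B : Module.End ℂ (SuperFun m n)) : Prop :=
  ∃ (hA : ∀ f ∈ polyGauss m n, A f ∈ polyGauss m n)
    (hB : ∀ f ∈ polyGauss m n, B f ∈ polyGauss m n),
    ∀ f g : polyGauss m n, inner2 (A.restrict hA f) g = inner2 f (B.restrict hB g)

end SuperSpace

end

noncomputable section

namespace SuperSpace

/-! ### Operators satisfying the `sl₂` relations -/

/-! The form depends on four ingredients: the product, the superintegral, complex conjugation and
`T`. An operator `A` that can be moved across the product under the integral, and that commutes with
conjugation and with `T`, satisfies `A† = A`. Multiplication by `R²` moves across because `θ²` is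
central (`mulR2_mul`). For `∇²` this is integration by parts, twice in each commuting and each
anticommuting variable; the Gaussian removes boundary terms (`superInt_lap_mul`). Conjugation
commutes with both, since both have real coefficients. What remains is `T`.

The operators `X = R²`, `Y = ∇²`, `H = 𝔼 + M/2` satisfy `[H, X] = 2X` and `[Y, X] = 4H`. Conjugating
by the Gaussian turns `∇²` into `∇² - 2H + R²` on polynomials (`lap_mulGauss`). On the pieces
`R^{2j} f_{i,p,q} H^b H^f` the operators `X`, `Y`, `H` only shift `j` and multiply by scalars that
depend on the indices alone. As `T` only replaces `H^f` by another harmonic of the same degree and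
multiplies by a sign independent of `j`, it commutes with all three.

The existence and uniqueness of `T` amount to the super Fischer decomposition. The pieces span: each
factor of the tensor product has its own Fischer decomposition, and inside a block `r^{2a} θ^{2b}
H^b H^f` one works modulo `R²`, where `r² = -θ²` (`radial_mem_span_fischerElt`). The pieces are
independent: they lie in distinct joint eigenspaces of `H`, `R²∇²` and the two Casimir operators
(`fischerEigenvalue_injective`). Both halves use `M > 0`.

Finally `2𝔼 + M = [∇², R²]/2` is half a commutator of symmetric operators, hence antisymmetric, and
the Schrödinger operator is a real polynomial expression in symmetric operators. -/

/-- The relations `[H, X] = 2 X` and `[Y, X] = 4 H` between three operators. -/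
structure SlTriple {V : Type*} [AddCommGroup V] [Module ℂ V] (X Y H : Module.End ℂ V) : Prop where
  weight_raise : ∀ v, H (X v) = X (H v) + (2 : ℂ) • X v
  lower_raise : ∀ v, Y (X v) = X (Y v) + (4 : ℂ) • H v

namespace SlTriple

section

variable {V : Type*} [AddCommGroup V] [Module ℂ V] {X Y H : Module.End ℂ V}

theorem weight_raise_pow (t : SlTriple X Y H) (j : ℕ) (v : V) :
    H ((X ^ j) v) = (X ^ j) (H v) + (2 * j : ℂ) • (X ^ j) v := by
  induction j with
  | zero => simp
  | succ j ih =>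
    rw [pow_succ', Module.End.mul_apply, Module.End.mul_apply, t.weight_raise, ih, map_add,
      map_smul, add_assoc, ← add_smul]
    push_cast
    ring_nf

theorem weight_raise_pow_of_eigen (t : SlTriple X Y H) (j : ℕ) {v : V} {c : ℂ} (hv : H v = c • v) :
    H ((X ^ j) v) = (c + 2 * j) • (X ^ j) v := by
  rw [t.weight_raise_pow, hv, map_smul, ← add_smul]

/-- Moving `Y` past `j + 1` copies of `X` leaves a `4H` at each place, and moving that `H` to the
right past `i` copies of `X` adds `2i`. Summing `4(H + 2i)` over `i ≤ j` gives `4(j + 1)(H + j)`. -/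
theorem lower_raise_pow (t : SlTriple X Y H) (j : ℕ) (v : V) :
    Y ((X ^ (j + 1)) v)
      = (X ^ (j + 1)) (Y v) + (4 * (j + 1) : ℂ) • (X ^ j) (H v + (j : ℂ) • v) := by
  induction j with
  | zero => simp [t.lower_raise]
  | succ j ih =>
    rw [pow_succ', Module.End.mul_apply, t.lower_raise, ih, t.weight_raise_pow, map_add X,
      map_smul X, ← Module.End.mul_apply X, ← pow_succ', ← Module.End.mul_apply X, ← pow_succ',
      map_add, map_add, map_smul, map_smul]
    push_cast
    module

theorem lower_raise_pow_of_eigen (t : SlTriple X Y H) (j : ℕ) {v : V} {c : ℂ} (hv : H v = c • v) :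
    Y ((X ^ (j + 1)) v)
      = (X ^ (j + 1)) (Y v) + (4 * (j + 1) * (c + j) : ℂ) • (X ^ j) v := by
  rw [t.lower_raise_pow, hv, ← add_smul, map_smul, smul_smul]

theorem lower_raise_pow_of_ker (t : SlTriple X Y H) (j : ℕ) {v : V} {c : ℂ} (hv : H v = c • v)
    (h0 : Y v = 0) :
    Y ((X ^ (j + 1)) v) = (4 * (j + 1) * (c + j) : ℂ) • (X ^ j) v := by
  rw [t.lower_raise_pow_of_eigen j hv, h0, map_zero, zero_add]

/-- `X Y` is diagonal on the vectors `X ^ j v` over a lowest weight vector. -/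
theorem raise_lower_pow_of_ker (t : SlTriple X Y H) (j : ℕ) {v : V} {c : ℂ} (hv : H v = c • v)
    (h0 : Y v = 0) :
    X (Y ((X ^ j) v)) = (4 * j * (c + j - 1) : ℂ) • (X ^ j) v := by
  cases j with
  | zero => simp [h0]
  | succ j =>
    rw [t.lower_raise_pow_of_ker j hv h0, map_smul, pow_succ', Module.End.mul_apply]
    push_cast
    ring_nf

/-- The Casimir operator. -/
theorem casimir_pow_of_ker (t : SlTriple X Y H) (j : ℕ) {v : V} {c : ℂ} (hv : H v = c • v)
    (h0 : Y v = 0) :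
    (X * Y - H * H + (2 : ℂ) • H) ((X ^ j) v) = (-(c * (c - 2))) • (X ^ j) v := by
  simp only [LinearMap.add_apply, LinearMap.sub_apply, Module.End.mul_apply, LinearMap.smul_apply,
    t.raise_lower_pow_of_ker j hv h0, t.weight_raise_pow_of_eigen j hv, map_smul]
  module

/-- If `X` is nilpotent, then `X ^ j` kills a lowest weight vector once the weight is positive. -/
theorem pow_eq_zero_of_ker (t : SlTriple X Y H) {N : ℕ} (hN : X ^ N = 0) {v : V} {c : ℂ}
    (hv : H v = c • v) (h0 : Y v = 0) {j : ℕ} (hj : ∀ i ≥ j, c + i ≠ 0) : (X ^ j) v = 0 := by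
  -- Descending induction on `i`, starting at `N + j`. Applying `Y` to `X ^ (i + 1) v = 0` gives
  -- `4(i + 1)(c + i) X ^ i v = 0`.
  have key : ∀ k i, j ≤ i → i + k = N + j → (X ^ i) v = 0 := by
    intro k
    induction k with
    | zero =>
      intro i _ hi
      rw [show i = N + j by omega, pow_add, hN, zero_mul]
      rfl
    | succ k ih =>
      intro i hji hi
      have h := t.lower_raise_pow_of_ker i hv h0
      rw [ih (i + 1) (by omega) (by omega), map_zero] at h
      refine (smul_eq_zero.1 h.symm).resolve_left (mul_ne_zero ?_ (hj i hji))
      exact mul_ne_zero (by norm_num) (Nat.cast_add_one_ne_zero i)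
  exact key N j le_rfl (by omega)

end

/-! ### The Fischer decomposition -/

section Fischer

variable {V : Type*} [AddCommGroup V] [Module ℂ V] {X Y H : Module.End ℂ V}

/-- The span of the vectors `X ^ j h` of degree `k` over the lowest weight vectors `h`. -/
def fischer (X Y : Module.End ℂ V) (W : ℕ → Submodule ℂ V) (k : ℕ) : Submodule ℂ V :=
  Submodule.span ℂ {u | ∃ j q, 2 * j + q = k ∧ ∃ h ∈ W q, Y h = 0 ∧ u = (X ^ j) h}

variable {W : ℕ → Submodule ℂ V} {c : ℂ}

theorem raise_mem_fischer {k : ℕ} {u : V} (hu : u ∈ fischer X Y W k) :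
    X u ∈ fischer X Y W (k + 2) := by
  induction hu using Submodule.span_induction with
  | mem u hu =>
    obtain ⟨j, q, hk, h, hW, hY, rfl⟩ := hu
    exact Submodule.subset_span ⟨j + 1, q, by omega, h, hW, hY, by
      rw [pow_succ', Module.End.mul_apply]⟩
  | zero => simp
  | add u v _ _ hu hv => rw [map_add]; exact add_mem hu hv
  | smul a u _ hu => rw [map_smul]; exact Submodule.smul_mem _ _ hu

theorem raise_pow_mem_fischer {k : ℕ} {u : V} (i : ℕ) (hu : u ∈ fischer X Y W k) :
    (X ^ i) u ∈ fischer X Y W (k + 2 * i) := by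
  induction i with
  | zero => simpa using hu
  | succ i ih => rw [pow_succ', Module.End.mul_apply]; exact raise_mem_fischer ih

theorem lower_mem_fischer (t : SlTriple X Y H) (hH : ∀ k, ∀ v ∈ W k, H v = ((k : ℂ) + c) • v)
    {k : ℕ} {u : V} (hu : u ∈ fischer X Y W (k + 2)) :
    Y u ∈ fischer X Y W k := by
  induction hu using Submodule.span_induction with
  | mem u hu =>
    obtain ⟨j, q, hk, h, hW, hY, rfl⟩ := hu
    cases j with
    | zero => simp [hY]
    | succ j =>
      rw [t.lower_raise_pow_of_ker j (hH q h hW) hY]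
      exact Submodule.smul_mem _ _ (Submodule.subset_span ⟨j, q, by omega, h, hW, hY, rfl⟩)
  | zero => simp
  | add u v _ _ hu hv => rw [map_add]; exact add_mem hu hv
  | smul a u _ hu => rw [map_smul]; exact Submodule.smul_mem _ _ hu

theorem fischer_le (hX : ∀ k, ∀ v ∈ W k, X v ∈ W (k + 2)) (k : ℕ) : fischer X Y W k ≤ W k := by
  refine Submodule.span_le.2 ?_
  rintro _ ⟨j, q, rfl, h, hW, -, rfl⟩
  induction j with
  | zero => simpa using hW
  | succ j ih =>
    rw [pow_succ', Module.End.mul_apply, show 2 * (j + 1) + q = 2 * j + q + 2 by ring]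
    exact hX _ _ ih

theorem le_fischer_of_ker {k : ℕ} (hY : ∀ v ∈ W k, Y v = 0) : W k ≤ fischer X Y W k :=
  fun v hv => Submodule.subset_span ⟨0, k, by omega, v, hv, hY v hv, rfl⟩

/-- Since the scalars `4(j + 1)(q + c + j)` do not vanish, `Y` maps degree `k + 2` of the Fischer
span onto degree `k`. Subtracting from `v` a preimage of `Y v` leaves a vector killed by `Y`. -/
theorem le_fischer_add_two (t : SlTriple X Y H) (hH : ∀ k, ∀ v ∈ W k, H v = ((k : ℂ) + c) • v)
    (hX : ∀ k, ∀ v ∈ W k, X v ∈ W (k + 2)) (hY : ∀ k, ∀ v ∈ W (k + 2), Y v ∈ W k) {k : ℕ}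
    (hk : W k ≤ fischer X Y W k) (hc : ∀ j q : ℕ, 2 * j + q = k → (q : ℂ) + c + j ≠ 0) :
    W (k + 2) ≤ fischer X Y W (k + 2) := by
  have lift : ∀ u ∈ fischer X Y W k, ∃ v ∈ fischer X Y W (k + 2), Y v = u := by
    intro u hu
    induction hu using Submodule.span_induction with
    | mem u hu =>
      obtain ⟨j, q, hjq, h, hW, hY0, rfl⟩ := hu
      have hne : (4 * (j + 1) * ((q : ℂ) + c + j)) ≠ 0 :=
        mul_ne_zero (mul_ne_zero (by norm_num) (Nat.cast_add_one_ne_zero j)) (hc j q hjq)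
      refine ⟨(4 * (j + 1) * ((q : ℂ) + c + j))⁻¹ • (X ^ (j + 1)) h,
        Submodule.smul_mem _ _ (Submodule.subset_span ⟨j + 1, q, by omega, h, hW, hY0, rfl⟩), ?_⟩
      rw [map_smul, t.lower_raise_pow_of_ker j (hH q h hW) hY0, smul_smul, inv_mul_cancel₀ hne,
        one_smul]
    | zero => exact ⟨0, zero_mem _, map_zero _⟩
    | add u v _ _ hu hv =>
      obtain ⟨u', hu', rfl⟩ := hu
      obtain ⟨v', hv', rfl⟩ := hv
      exact ⟨u' + v', add_mem hu' hv', map_add _ _ _⟩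
    | smul a u _ hu =>
      obtain ⟨u', hu', rfl⟩ := hu
      exact ⟨a • u', Submodule.smul_mem _ _ hu', map_smul _ _ _⟩
  intro v hv
  obtain ⟨u, hu, huv⟩ := lift _ (hk (hY k v hv))
  have hvu : v - u ∈ fischer X Y W (k + 2) :=
    Submodule.subset_span ⟨0, k + 2, by omega, v - u,
      sub_mem hv (fischer_le hX _ hu), by rw [map_sub, huv, sub_self], rfl⟩
  simpa using add_mem hvu hu

/-- Replaces `le_fischer_add_two` in high degrees, where the scalars there may vanish. `X ^ i v` is
recovered from `Y X ^ (i + 1) v - X ^ (i + 1) Y v`, so membership descends from `X ^ N v = 0` to `v`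
itself. -/
theorem le_fischer_add_two_of_nilpotent (t : SlTriple X Y H)
    (hH : ∀ k, ∀ v ∈ W k, H v = ((k : ℂ) + c) • v) (hY : ∀ k, ∀ v ∈ W (k + 2), Y v ∈ W k)
    {N : ℕ} (hN : X ^ N = 0) {k : ℕ} (hk : W k ≤ fischer X Y W k)
    (hc : ∀ i : ℕ, ((k + 2 : ℕ) : ℂ) + c + i ≠ 0) :
    W (k + 2) ≤ fischer X Y W (k + 2) := by
  intro v hv
  have key : ∀ l i, i + l = N → (X ^ i) v ∈ fischer X Y W (k + 2 + 2 * i) := by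
    intro l
    induction l with
    | zero =>
      intro i hi
      rw [show i = N by omega, hN]
      exact zero_mem _
    | succ l ih =>
      intro i hi
      have h := t.lower_raise_pow_of_eigen i (hH _ v hv)
      have h1 : Y ((X ^ (i + 1)) v) ∈ fischer X Y W (k + 2 + 2 * i) :=
        lower_mem_fischer t hH (ih (i + 1) (by omega))
      have h2 : (X ^ (i + 1)) (Y v) ∈ fischer X Y W (k + 2 + 2 * i) := by
        have := raise_pow_mem_fischer (i + 1) (hk (hY k v hv))
        rwa [show k + 2 * (i + 1) = k + 2 + 2 * i by ring] at this
      have h3 := sub_mem h1 h2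
      rw [h, add_sub_cancel_left] at h3
      refine (Submodule.smul_mem_iff _ ?_).1 h3
      exact mul_ne_zero (mul_ne_zero (by norm_num) (Nat.cast_add_one_ne_zero i)) (hc i)
  simpa using key N 0 (by omega)

end Fischer

/-! ### Constructions -/

/-- The shift comes from `[d², x²] = 4 x d + 2` in one variable: the constant `2` is `4` times one
half, once per variable. -/
theorem of_weyl {V ι : Type*} [AddCommGroup V] [Module ℂ V] [Fintype ι] [DecidableEq ι]
    (x d : ι → Module.End ℂ V) (hxx : ∀ i j, x i * x j = x j * x i)
    (hdx : ∀ i j, d i * x j = x j * d i + if i = j then 1 else 0) :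
    SlTriple (∑ i, x i * x i) (∑ i, d i * d i)
      ((∑ i, x i * d i) + ((Fintype.card ι : ℂ) / 2) • 1) := by
  have h1 : ∀ i j, (x i * d i) * (x j * x j)
      = (x j * x j) * (x i * d i) + if i = j then (2 : ℂ) • (x j * x j) else 0 := by
    intro i j
    have e : (x i * d i) * (x j * x j)
        = x i * (d i * x j) * x j := by noncomm_ring
    have e' : x i * (x j * d i) * x j = x i * x j * (d i * x j) := by noncomm_ring
    have e'' : x i * x j * (x j * d i) = (x j * x j) * (x i * d i) := by
      rw [← mul_assoc, mul_assoc (x i), mul_assoc (x i), ← mul_assoc (x i),  ← mul_assoc (x i),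
        hxx i j, mul_assoc (x j), hxx i j, ← mul_assoc, mul_assoc]
    rw [e, hdx, mul_add, add_mul, e', hdx, mul_add, e'']
    split_ifs with h
    · subst h
      simp only [mul_one, two_smul, add_assoc]
    · simp
  have h2 : ∀ i j, (d i * d i) * (x j * x j)
      = (x j * x j) * (d i * d i) + if i = j then (4 : ℂ) • (x i * d i) + (2 : ℂ) • 1 else 0 := by
    intro i j
    have e : (d i * d i) * (x j * x j) = d i * (d i * x j) * x j := by noncomm_ring
    rw [e, hdx]
    split_ifs with h
    · subst h
      have e1 : d i * (x i * d i + 1) * x i = (d i * x i) * (d i * x i) + d i * x i := by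
        noncomm_ring
      have e2 : x i * d i * (x i * d i) = x i * (d i * x i) * d i := by noncomm_ring
      rw [e1, hdx, if_pos rfl, add_mul, mul_add, e2, hdx, if_pos rfl]
      simp only [mul_add, add_mul, mul_one, one_mul, mul_assoc]
      module
    · have e1 : d i * (x j * d i + 0) * x j = (d i * x j) * (d i * x j) := by noncomm_ring
      have e2 : x j * d i * (x j * d i) = x j * (d i * x j) * d i := by noncomm_ring
      rw [e1, hdx, if_neg h, add_zero, e2, hdx, if_neg h]
      noncomm_ring
  have H1 : ((∑ i, x i * d i) + ((Fintype.card ι : ℂ) / 2) • 1) * (∑ i, x i * x i)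
      = (∑ i, x i * x i) * ((∑ i, x i * d i) + ((Fintype.card ι : ℂ) / 2) • 1)
        + (2 : ℂ) • ∑ i, x i * x i := by
    have : (∑ i, x i * d i) * (∑ i, x i * x i)
        = (∑ i, x i * x i) * (∑ i, x i * d i) + (2 : ℂ) • ∑ i, x i * x i := by
      rw [Finset.sum_mul_sum, Finset.sum_mul_sum, Finset.sum_comm, Finset.smul_sum,
        ← Finset.sum_add_distrib]
      refine Finset.sum_congr rfl fun j _ => ?_
      simp only [h1, Finset.sum_add_distrib, Finset.sum_ite_eq', Finset.mem_univ, if_true]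
    rw [add_mul, this, mul_add, smul_mul_assoc, one_mul, mul_smul_comm, mul_one]
    abel
  have H2 : (∑ i, d i * d i) * (∑ i, x i * x i)
      = (∑ i, x i * x i) * (∑ i, d i * d i)
        + (4 : ℂ) • ((∑ i, x i * d i) + ((Fintype.card ι : ℂ) / 2) • 1) := by
    rw [Finset.sum_mul_sum, Finset.sum_mul_sum, Finset.sum_comm]
    simp only [h2, Finset.sum_add_distrib, Finset.sum_ite_eq', Finset.mem_univ, if_true,
      ← Finset.smul_sum, Finset.sum_const, Finset.card_univ]
    rw [← Nat.cast_smul_eq_nsmul ℂ]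
    module
  exact ⟨fun v => by simpa using congr($H1 v), fun v => by simpa using congr($H2 v)⟩

/-- Operators on different factors commute, so the relations add up, and so do the weights: `m/2`
from the commuting and `-n` from the anticommuting variables give `M/2`. -/
theorem tensor {V W : Type*} [AddCommGroup V] [Module ℂ V] [AddCommGroup W] [Module ℂ W]
    {X Y H : Module.End ℂ V} {X' Y' H' : Module.End ℂ W} (t : SlTriple X Y H)
    (t' : SlTriple X' Y' H') :
    SlTriple (LinearMap.rTensor W X + LinearMap.lTensor V X')
      (LinearMap.rTensor W Y + LinearMap.lTensor V Y')
      (LinearMap.rTensor W H + LinearMap.lTensor V H') := by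
  constructor <;> intro z <;>
  induction z using TensorProduct.induction_on with
  | zero => simp
  | tmul v w =>
    simp only [LinearMap.add_apply, LinearMap.rTensor_tmul, LinearMap.lTensor_tmul, map_add,
      t.weight_raise, t'.weight_raise, t.lower_raise, t'.lower_raise, TensorProduct.add_tmul,
      TensorProduct.tmul_add, TensorProduct.tmul_smul, ← TensorProduct.smul_tmul']
    module
  | add a b ha hb =>
    simp only [map_add, smul_add, ha, hb]
    abel

end SlTriple

/-! ### Operators acting by scalars on joint eigenspaces -/

/-- Joint eigenspaces for distinct systems of eigenvalues are independent; when they also span, a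
scalar may be prescribed on each of them freely. -/
theorem exists_scalar_operator {ι T V : Type*} [AddCommGroup V] [Module ℂ V]
    (A : ι → Module.End ℂ V) (χ : T → ι → ℂ) (hχ : Function.Injective χ) (U : T → Submodule ℂ V)
    (hU : ⨆ t, U t = ⊤) (hA : ∀ t, ∀ u ∈ U t, ∀ i, A i u = χ t i • u) (c : T → ℂ) :
    ∃ S : Module.End ℂ V, ∀ t, ∀ u ∈ U t, S u = c t • u := by
  classical
  -- Commutativity need not be assumed: on each `U t` both operators are scalars, and these
  -- subspaces span.
  have hcomm : ∀ i j, Commute (A i) (A j) := by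
    intro i j
    refine LinearMap.ext fun v => ?_
    have hv : v ∈ ⨆ t, U t := hU ▸ Submodule.mem_top
    induction hv using Submodule.iSup_induction' with
    | mem t u hu => simp only [Module.End.mul_apply, hA t u hu, map_smul, smul_smul, mul_comm]
    | zero => simp
    | add u v _ _ hu hv => rw [map_add, map_add, hu, hv]
  have hind : iSupIndep U := by
    have h := Module.End.independent_iInf_maxGenEigenspace_of_forall_mapsTo A
      (fun i j φ => Module.End.mapsTo_maxGenEigenspace_of_comm (hcomm j i) φ)
    refine (h.comp hχ).mono fun t u hu => ?_
    refine (Submodule.mem_iInf _).2 fun i => ?_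
    exact Module.End.mem_maxGenEigenspace _ _ _ |>.2 ⟨1, by simp [hA t u hu i]⟩
  have hint : DirectSum.IsInternal U :=
    DirectSum.isInternal_submodule_of_iSupIndep_of_iSup_eq_top hind hU
  let e := LinearEquiv.ofBijective (DirectSum.coeLinearMap U) hint
  refine ⟨(DirectSum.toModule ℂ T V fun t => c t • (U t).subtype) ∘ₗ e.symm.toLinearMap, ?_⟩
  intro t u hu
  have he : e.symm u = DirectSum.lof ℂ T (fun t => U t) t ⟨u, hu⟩ := by
    rw [LinearEquiv.symm_apply_eq]
    exact (DirectSum.coeLinearMap_lof U t ⟨u, hu⟩).symm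
  simp [he]

/-! ### The Grassmann algebra -/

section GrassmannFacts

variable {n : ℕ}


theorem grassmann_induction {C : Grassmann n → Prop} (h1 : C 1)
    (hadd : ∀ x y, C x → C y → C (x + y)) (hsmul : ∀ (c : ℂ) x, C x → C (c • x))
    (hmul : ∀ v x, C x → C (ExteriorAlgebra.ι ℂ v * x)) (x : Grassmann n) : C x := by
  induction x using CliffordAlgebra.left_induction with
  | algebraMap r => rw [Algebra.algebraMap_eq_smul_one]; exact hsmul r _ h1
  | add x y hx hy => exact hadd x y hx hy
  | ι_mul x v hx => exact hmul v x hx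

theorem gDeriv_ι_mul (k : Fin (2 * n)) (v : Fin (2 * n) → ℂ) (a : Grassmann n) :
    gDeriv k (ExteriorAlgebra.ι ℂ v * a) = v k • a - ExteriorAlgebra.ι ℂ v * gDeriv k a :=
  CliffordAlgebra.contractLeft_ι_mul _ _ _

theorem gDeriv_gen_mul (k l : Fin (2 * n)) (a : Grassmann n) :
    gDeriv k (gen l * a) = (if k = l then (1 : ℂ) else 0) • a - gen l * gDeriv k a := by
  rw [gen, gDeriv_ι_mul, Pi.single_apply]

theorem gDeriv_one (k : Fin (2 * n)) : gDeriv k (1 : Grassmann n) = 0 :=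
  CliffordAlgebra.contractLeft_one _ _

theorem gDeriv_mul_self (k : Fin (2 * n)) : gDeriv (n := n) k * gDeriv k = 0 :=
  LinearMap.ext fun a => CliffordAlgebra.contractLeft_contractLeft _ a

theorem gDeriv_gDeriv_swap (k l : Fin (2 * n)) (a : Grassmann n) :
    gDeriv k (gDeriv l a) = -gDeriv l (gDeriv k a) :=
  CliffordAlgebra.contractLeft_comm _ _ a

theorem ι_mul_swap (v w : Fin (2 * n) → ℂ) : ExteriorAlgebra.ι ℂ v * ExteriorAlgebra.ι ℂ w = -(ExteriorAlgebra.ι ℂ w * ExteriorAlgebra.ι ℂ v) :=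
  eq_neg_of_add_eq_zero_left (ExteriorAlgebra.ι_add_mul_swap v w)

theorem ι_eq_sum (v : Fin (2 * n) → ℂ) : ExteriorAlgebra.ι ℂ v = ∑ k, v k • gen k := by
  conv_lhs => rw [pi_eq_sum_univ' v, map_sum]
  refine Finset.sum_congr rfl fun k _ => ?_
  rw [map_smul, gen]

theorem eulerF_ι_mul (v : Fin (2 * n) → ℂ) (a : Grassmann n) :
    eulerF n (ExteriorAlgebra.ι ℂ v * a) = ExteriorAlgebra.ι ℂ v * a + ExteriorAlgebra.ι ℂ v * eulerF n a := by
  simp only [eulerF, LinearMap.sum_apply, Module.End.mul_apply, LinearMap.mulLeft_apply,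
    gDeriv_ι_mul, mul_sub, Finset.sum_sub_distrib, mul_smul_comm, Finset.mul_sum, ← mul_assoc]
  rw [sub_eq_add_neg, ← Finset.sum_neg_distrib]
  congr 1
  · simp only [← smul_mul_assoc, ← Finset.sum_mul, ← ι_eq_sum]
  · refine Finset.sum_congr rfl fun k _ => ?_
    rw [gen, ι_mul_swap, neg_mul, neg_neg]

theorem eulerF_one : eulerF n (1 : Grassmann n) = 0 := by
  simp [eulerF, gDeriv_one]

theorem eulerF_of_mem {q : ℕ} {a : Grassmann n} (ha : a ∈ ⋀[ℂ]^q (Fin (2 * n) → ℂ)) :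
    eulerF n a = (q : ℂ) • a := by
  induction ha using Submodule.pow_induction_on_left' with
  | algebraMap r =>
    rw [Algebra.algebraMap_eq_smul_one, map_smul, eulerF_one]
    simp
  | add x y i _ _ hx hy => rw [map_add, hx, hy, smul_add]
  | mem_mul w hw i x _ hx =>
    obtain ⟨v, rfl⟩ := hw
    rw [eulerF_ι_mul, hx, mul_smul_comm]
    push_cast
    module

theorem gDeriv_eq_zero_of_mem_zero {a : Grassmann n} (ha : a ∈ ⋀[ℂ]^0 (Fin (2 * n) → ℂ))
    (k : Fin (2 * n)) : gDeriv k a = 0 := by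
  rw [ExteriorAlgebra.exteriorPower, pow_zero] at ha
  obtain ⟨r, rfl⟩ := Submodule.mem_one.1 ha
  exact CliffordAlgebra.contractLeft_algebraMap _ _ _

theorem gDeriv_mem {q : ℕ} {a : Grassmann n} (ha : a ∈ ⋀[ℂ]^(q + 1) (Fin (2 * n) → ℂ))
    (k : Fin (2 * n)) : gDeriv k a ∈ ⋀[ℂ]^q (Fin (2 * n) → ℂ) := by
  -- The degree is freed to an arbitrary `r`, with `r = q + 1` as a hypothesis, so that induction on
  -- membership applies.
  have key : ∀ r (a : Grassmann n), a ∈ ⋀[ℂ]^r (Fin (2 * n) → ℂ) →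
      ∀ q, r = q + 1 → gDeriv k a ∈ ⋀[ℂ]^q (Fin (2 * n) → ℂ) := by
    intro r a ha
    induction ha using Submodule.pow_induction_on_left' with
    | algebraMap r => intro q hq; omega
    | add x y i _ _ hx hy => intro q hq; rw [map_add]; exact add_mem (hx q hq) (hy q hq)
    | mem_mul w hw i x hx' hx =>
      intro q hq
      obtain rfl : i = q := by omega
      obtain ⟨v, rfl⟩ := hw
      rw [gDeriv_ι_mul]
      refine sub_mem (Submodule.smul_mem _ _ hx') ?_
      cases i with
      | zero => rw [gDeriv_eq_zero_of_mem_zero hx', mul_zero]; exact zero_mem _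
      | succ i =>
        rw [ExteriorAlgebra.exteriorPower, pow_succ']
        exact Submodule.mul_mem_mul (LinearMap.mem_range_self _ v) (hx i rfl)
  exact key _ a ha q rfl

theorem lapF_mem {q : ℕ} {a : Grassmann n} (ha : a ∈ ⋀[ℂ]^(q + 2) (Fin (2 * n) → ℂ)) :
    lapF n a ∈ ⋀[ℂ]^q (Fin (2 * n) → ℂ) := by
  simp only [lapF, LinearMap.smul_apply, LinearMap.sum_apply, Module.End.mul_apply]
  exact Submodule.smul_mem _ _ (sum_mem fun j _ => gDeriv_mem (gDeriv_mem ha _) _)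

theorem lapF_eq_zero_of_mem_zero {a : Grassmann n} (ha : a ∈ ⋀[ℂ]^0 (Fin (2 * n) → ℂ)) :
    lapF n a = 0 := by
  simp [lapF, gDeriv_eq_zero_of_mem_zero ha]

theorem lapF_eq_zero_of_mem_one {a : Grassmann n} (ha : a ∈ ⋀[ℂ]^1 (Fin (2 * n) → ℂ)) :
    lapF n a = 0 := by
  simp [lapF, gDeriv_eq_zero_of_mem_zero (gDeriv_mem ha _)]

theorem gen_mul_gen_swap (k l : Fin (2 * n)) : (gen k * gen l : Grassmann n) = -(gen l * gen k) :=
  ι_mul_swap _ _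

theorem gen_mul_self (k : Fin (2 * n)) : (gen k * gen k : Grassmann n) = 0 :=
  ExteriorAlgebra.ι_sq_zero _

theorem commute_gen_mul_gen (k l : Fin (2 * n)) (a : Grassmann n) :
    Commute (gen k * gen l) a := by
  induction a using grassmann_induction with
  | h1 => exact Commute.one_right _
  | hadd x y hx hy => exact hx.add_right hy
  | hsmul c x hx => exact hx.smul_right c
  | hmul v x hx =>
    refine Commute.mul_right ?_ hx
    change gen k * gen l * ExteriorAlgebra.ι ℂ v = ExteriorAlgebra.ι ℂ v * (gen k * gen l)
    rw [mul_assoc, gen, gen, ι_mul_swap (Pi.single l 1) v, mul_neg, ← mul_assoc,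
      ι_mul_swap (Pi.single k 1) v, neg_mul, neg_neg, mul_assoc]

theorem commute_theta2 (a : Grassmann n) : Commute (theta2 n) a :=
  (Commute.sum_left _ _ _ fun _ _ => commute_gen_mul_gen _ _ a).neg_left

theorem isNilpotent_theta2 : IsNilpotent (theta2 n) := by
  refine IsNilpotent.neg (Commute.isNilpotent_sum (fun j _ => ⟨2, ?_⟩)
    fun i j _ _ => commute_gen_mul_gen _ _ _)
  rw [pow_two, mul_assoc, ← mul_assoc (gen (even j)), gen_mul_gen_swap (even j), neg_mul,
    mul_assoc, gen_mul_self]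
  simp

theorem odd_ne_even (i j : Fin n) : odd i ≠ even j := by
  intro h
  have := congrArg Fin.val h
  simp only [odd, even] at this
  omega

theorem odd_inj {i j : Fin n} : odd i = odd j ↔ i = j := by
  simp [odd, Fin.ext_iff]

theorem even_inj {i j : Fin n} : even i = even j ↔ i = j := by
  simp [even, Fin.ext_iff]

theorem sum_odd_even {A : Type*} [AddCommMonoid A] (f : Fin (2 * n) → A) :
    ∑ k, f k = ∑ j : Fin n, (f (odd j) + f (even j)) := by
  rw [← (finProdFinEquiv (m := n) (n := 2)).trans (finCongr (mul_comm n 2)) |>.sum_comp,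
    Fintype.sum_prod_type]
  refine Finset.sum_congr rfl fun j _ => ?_
  rw [Fin.sum_univ_two]
  congr 2 <;> ext <;> simp [odd, even, finProdFinEquiv]; ring

/-- The term `- a`, one for each pair of generators, is the source of the shift `-n` in the
fermionic weight. -/
theorem gDeriv_gDeriv_gen_mul_gen (i j : Fin n) (a : Grassmann n) :
    gDeriv (odd i) (gDeriv (even i) (gen (odd j) * gen (even j) * a))
      = gen (odd j) * gen (even j) * gDeriv (odd i) (gDeriv (even i) a)
        + if i = j then gen (odd i) * gDeriv (odd i) a + gen (even i) * gDeriv (even i) a - a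
          else 0 := by
  have h1 : (odd i = even j) = False := eq_false (odd_ne_even i j)
  have h2 : (even i = odd j) = False := eq_false (odd_ne_even j i).symm
  simp only [mul_assoc, gDeriv_gen_mul, h1, h2, odd_inj, even_inj, if_false, zero_smul, zero_sub,
    map_neg, map_sub, map_smul, mul_sub, mul_smul_comm]
  split_ifs with h
  · subst h
    simp only [one_smul, mul_neg]
    abel
  · simp

theorem slTriple_grassmann :
    SlTriple (LinearMap.mulLeft ℂ (theta2 n)) (lapF n) (eulerF n - (n : ℂ) • 1) := by
  constructor
  · intro a
    have h : ∀ j : Fin n, eulerF n (gen (odd j) * (gen (even j) * a))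
        = gen (odd j) * (gen (even j) * eulerF n a) + (2 : ℂ) • (gen (odd j) * (gen (even j) * a)) := by
      intro j
      simp only [gen, eulerF_ι_mul, mul_add]
      module
    simp only [LinearMap.mulLeft_apply, LinearMap.sub_apply, LinearMap.smul_apply,
      Module.End.one_apply, theta2, neg_mul, Finset.sum_mul, map_neg, map_sum, mul_assoc, h,
      Finset.sum_add_distrib, ← Finset.smul_sum, mul_sub, mul_smul_comm, Finset.sum_sub_distrib]
    module
  · intro a
    simp only [LinearMap.mulLeft_apply, LinearMap.sub_apply, LinearMap.smul_apply,
      Module.End.one_apply, lapF, eulerF, theta2, neg_mul, Finset.sum_mul, map_neg, map_sum,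
      LinearMap.sum_apply, Module.End.mul_apply, gDeriv_gDeriv_gen_mul_gen]
    rw [sum_odd_even]
    simp only [Finset.sum_add_distrib, Finset.sum_ite_eq', Finset.mem_univ, if_true,
      Finset.mul_sum, mul_smul_comm, Finset.smul_sum, smul_add, smul_sub, Finset.sum_sub_distrib]
    simp only [← Finset.smul_sum, Finset.sum_const, Finset.card_univ, Fintype.card_fin,
      ← Nat.cast_smul_eq_nsmul ℂ]
    module

theorem mulLeft_theta2_pow (j : ℕ) (a : Grassmann n) :
    (LinearMap.mulLeft ℂ (theta2 n) ^ j) a = theta2 n ^ j * a := by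
  rw [LinearMap.pow_mulLeft, LinearMap.mulLeft_apply]

theorem exists_mulLeft_theta2_pow_eq_zero : ∃ N, LinearMap.mulLeft ℂ (theta2 n) ^ N = 0 := by
  obtain ⟨N, hN⟩ := isNilpotent_theta2 (n := n)
  exact ⟨N, by rw [LinearMap.pow_mulLeft, hN, LinearMap.mulLeft_zero_eq_zero]⟩

theorem weightF_of_mem {q : ℕ} {a : Grassmann n} (ha : a ∈ ⋀[ℂ]^q (Fin (2 * n) → ℂ)) :
    (eulerF n - (n : ℂ) • 1) a = ((q : ℂ) + -(n : ℂ)) • a := by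
  rw [LinearMap.sub_apply, eulerF_of_mem ha, LinearMap.smul_apply, Module.End.one_apply]
  module

/-- A harmonic of degree `q` has weight `q - n`, and `q - n + i` is nonzero for `i > n - q`; as `θ²`
is nilpotent, the string must already stop at `θ^{2(n-q)}`. This is why only `i + q ≤ n` occurs in
the decomposition. -/
theorem theta2_pow_mul_harmonic {q j : ℕ} (h : n < j + q) {w : Grassmann n}
    (hw : w ∈ harmonicF n q) : theta2 n ^ j * w = 0 := by
  obtain ⟨N, hN⟩ := exists_mulLeft_theta2_pow_eq_zero (n := n)
  rw [← mulLeft_theta2_pow]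
  refine slTriple_grassmann.pow_eq_zero_of_ker hN (weightF_of_mem hw.1) hw.2 fun i hi h0 => ?_
  have : ((q + i : ℕ) : ℂ) = (n : ℂ) := by
    push_cast
    linear_combination h0
  have := Nat.cast_injective this
  omega

theorem one_mem_harmonicF : (1 : Grassmann n) ∈ harmonicF n 0 := by
  have : (1 : Grassmann n) ∈ ⋀[ℂ]^0 (Fin (2 * n) → ℂ) := by
    rw [ExteriorAlgebra.exteriorPower, pow_zero]
    exact Submodule.one_le.1 le_rfl
  exact ⟨this, lapF_eq_zero_of_mem_zero this⟩

theorem theta2_pow_eq_zero : theta2 n ^ (n + 1) = 0 := by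
  simpa using theta2_pow_mul_harmonic (j := n + 1) (q := 0) (by omega) one_mem_harmonicF

theorem theta2_mul_mem {q : ℕ} {a : Grassmann n} (ha : a ∈ ⋀[ℂ]^q (Fin (2 * n) → ℂ)) :
    theta2 n * a ∈ ⋀[ℂ]^(q + 2) (Fin (2 * n) → ℂ) := by
  rw [theta2, neg_mul, Finset.sum_mul]
  refine neg_mem (sum_mem fun j _ => ?_)
  rw [mul_assoc, ExteriorAlgebra.exteriorPower, pow_succ', pow_succ']
  exact Submodule.mul_mem_mul (LinearMap.mem_range_self _ _)
    (Submodule.mul_mem_mul (LinearMap.mem_range_self _ _) ha)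

theorem le_fischer_grassmann (k : ℕ) :
    ⋀[ℂ]^k (Fin (2 * n) → ℂ) ≤ SlTriple.fischer (LinearMap.mulLeft ℂ (theta2 n)) (lapF n)
      (fun q => ⋀[ℂ]^q (Fin (2 * n) → ℂ)) k := by
  induction k using Nat.twoStepInduction with
  | zero => exact SlTriple.le_fischer_of_ker fun v hv => lapF_eq_zero_of_mem_zero hv
  | one => exact SlTriple.le_fischer_of_ker fun v hv => lapF_eq_zero_of_mem_one hv
  | more k ih _ =>
    -- For `k < n` one has `q + j ≤ k < n`, so the scalars `q + j - n` are nonzero. For `k ≥ n` they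
    -- can vanish, and nilpotency of `θ²` is used instead.
    rcases Nat.lt_or_ge k n with hk | hk
    · refine SlTriple.le_fischer_add_two slTriple_grassmann (fun q v hv => weightF_of_mem hv)
        (fun q v hv => theta2_mul_mem hv) (fun q v hv => lapF_mem hv) ih fun j q hjq h0 => ?_
      have : ((q + j : ℕ) : ℂ) = (n : ℂ) := by
        push_cast
        linear_combination h0
      have := Nat.cast_injective this
      omega
    · obtain ⟨N, hN⟩ := exists_mulLeft_theta2_pow_eq_zero (n := n)
      refine SlTriple.le_fischer_add_two_of_nilpotent slTriple_grassmann
        (fun q v hv => weightF_of_mem hv) (fun q v hv => lapF_mem hv) hN ih fun i h0 => ?_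
      have : ((k + 2 + i : ℕ) : ℂ) = (n : ℂ) := by
        push_cast at h0 ⊢
        linear_combination h0
      have := Nat.cast_injective this
      omega

/-- The fermionic Fischer decomposition. -/
theorem span_theta2_pow_mul_harmonic :
    Submodule.span ℂ {u : Grassmann n | ∃ j q, j + q ≤ n ∧ ∃ w ∈ harmonicF n q,
      u = theta2 n ^ j * w} = ⊤ := by
  refine eq_top_iff.2 fun a _ => ?_
  induction a using DirectSum.Decomposition.inductionOn
    (fun i => ⋀[ℂ]^i (Fin (2 * n) → ℂ)) with
  | zero => exact zero_mem _
  | add a b ha hb => exact add_mem (ha trivial) (hb trivial)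
  | @homogeneous k a =>
    refine (Submodule.span_le.2 ?_ : _ ≤ _) (le_fischer_grassmann k a.2)
    rintro _ ⟨j, q, -, w, hw, hY, rfl⟩
    rw [mulLeft_theta2_pow]
    by_cases hjq : j + q ≤ n
    · exact Submodule.subset_span ⟨j, q, hjq, w, ⟨hw, hY⟩, rfl⟩
    · rw [theta2_pow_mul_harmonic (by omega) ⟨hw, hY⟩]
      exact zero_mem _

/-! ### The twist on the Grassmann algebra -/

/-- The algebra endomorphism `x̀_{2j-1} ↦ x̀_{2j}`, `x̀_{2j} ↦ -x̀_{2j-1}`. -/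
def twistHom (n : ℕ) : Grassmann n →ₐ[ℂ] Grassmann n := ExteriorAlgebra.map (genTwist n)

theorem twistHom_ι (v : Fin (2 * n) → ℂ) : twistHom n (ExteriorAlgebra.ι ℂ v) = ExteriorAlgebra.ι ℂ (genTwist n v) :=
  ExteriorAlgebra.map_apply_ι _ _

theorem genTwist_odd (v : Fin (2 * n) → ℂ) (j : Fin n) : genTwist n v (odd j) = -v (even j) := by
  simp [genTwist, Pi.single_apply, odd_ne_even, odd_inj, Finset.sum_apply]

theorem genTwist_even (v : Fin (2 * n) → ℂ) (j : Fin n) : genTwist n v (even j) = v (odd j) := by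
  simp [genTwist, Pi.single_apply, (odd_ne_even _ _).symm, even_inj, Finset.sum_apply]

theorem twistHom_gen_odd (j : Fin n) : twistHom n (gen (odd j)) = gen (even j) := by
  rw [gen, twistHom_ι, gen]
  congr 1
  refine funext fun k => ?_
  simp [genTwist, Pi.single_apply, (odd_ne_even _ _).symm, odd_inj, Finset.sum_apply]

theorem twistHom_gen_even (j : Fin n) : twistHom n (gen (even j)) = -gen (odd j) := by
  rw [gen, twistHom_ι, gen, ← map_neg]
  congr 1
  refine funext fun k => ?_
  simp [genTwist, Pi.single_apply, odd_ne_even, even_inj, Finset.sum_apply]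

theorem twistHom_theta2 : twistHom n (theta2 n) = theta2 n := by
  simp only [theta2, map_neg, map_sum, map_mul, twistHom_gen_odd, twistHom_gen_even]
  congr 1
  refine Finset.sum_congr rfl fun j _ => ?_
  rw [mul_neg, gen_mul_gen_swap, neg_neg]

theorem gDeriv_odd_twistHom (j : Fin n) (a : Grassmann n) :
    gDeriv (odd j) (twistHom n a) = -twistHom n (gDeriv (even j) a) := by
  induction a using grassmann_induction with
  | h1 => simp [gDeriv_one]
  | hadd x y hx hy => simp only [map_add, hx, hy, neg_add]
  | hsmul c x hx => simp only [map_smul, hx, smul_neg]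
  | hmul v x hx =>
    simp only [map_mul, twistHom_ι, gDeriv_ι_mul, hx, genTwist_odd, map_sub, map_smul]
    rw [neg_smul, mul_neg]
    abel

theorem gDeriv_even_twistHom (j : Fin n) (a : Grassmann n) :
    gDeriv (even j) (twistHom n a) = twistHom n (gDeriv (odd j) a) := by
  induction a using grassmann_induction with
  | h1 => simp [gDeriv_one]
  | hadd x y hx hy => simp only [map_add, hx, hy]
  | hsmul c x hx => simp only [map_smul, hx]
  | hmul v x hx =>
    simp only [map_mul, twistHom_ι, gDeriv_ι_mul, hx, genTwist_even, map_sub, map_smul]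

theorem lapF_twistHom (a : Grassmann n) : lapF n (twistHom n a) = twistHom n (lapF n a) := by
  simp only [lapF, LinearMap.smul_apply, LinearMap.sum_apply, Module.End.mul_apply, map_smul,
    map_sum, gDeriv_even_twistHom, gDeriv_odd_twistHom]
  congr 1
  refine Finset.sum_congr rfl fun j _ => ?_
  rw [gDeriv_gDeriv_swap, map_neg, neg_neg]

theorem twistHom_mem {q : ℕ} {a : Grassmann n} (ha : a ∈ ⋀[ℂ]^q (Fin (2 * n) → ℂ)) :
    twistHom n a ∈ ⋀[ℂ]^q (Fin (2 * n) → ℂ) := by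
  induction ha using Submodule.pow_induction_on_left' with
  | algebraMap r =>
    rw [AlgHom.commutes, ExteriorAlgebra.exteriorPower, pow_zero]
    exact Submodule.algebraMap_mem r
  | add x y i _ _ hx hy => rw [map_add]; exact add_mem hx hy
  | mem_mul w hw i x _ hx =>
    obtain ⟨v, rfl⟩ := hw
    rw [map_mul, twistHom_ι, ExteriorAlgebra.exteriorPower, pow_succ']
    exact Submodule.mul_mem_mul (LinearMap.mem_range_self _ _) hx

theorem twistHom_mem_harmonicF {q : ℕ} {w : Grassmann n} (hw : w ∈ harmonicF n q) :
    twistHom n w ∈ harmonicF n q :=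
  ⟨twistHom_mem hw.1, by
    exact (lapF_twistHom w).trans ((congrArg _ hw.2).trans (map_zero _))⟩

/-- The sign of the order reversing permutation of `q` letters. -/
def reverseSign : ℕ → ℂ
  | 0 => 1
  | q + 1 => (-1) ^ q * reverseSign q

theorem mul_ι_of_mem {q : ℕ} {a : Grassmann n} (ha : a ∈ ⋀[ℂ]^q (Fin (2 * n) → ℂ))
    (v : Fin (2 * n) → ℂ) : a * ExteriorAlgebra.ι ℂ v = (-1 : ℂ) ^ q • (ExteriorAlgebra.ι ℂ v * a) := by
  induction ha using Submodule.pow_induction_on_left' with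
  | algebraMap r => rw [pow_zero, one_smul, Algebra.commutes]
  | add x y i _ _ hx hy => rw [add_mul, hx, hy, mul_add, smul_add]
  | mem_mul w hw i x _ hx =>
    obtain ⟨u, rfl⟩ := hw
    rw [mul_assoc, hx, mul_smul_comm, ← mul_assoc, ι_mul_swap, neg_mul, mul_assoc,
      pow_succ, mul_smul, neg_one_smul]

theorem reverse_of_mem {q : ℕ} {a : Grassmann n} (ha : a ∈ ⋀[ℂ]^q (Fin (2 * n) → ℂ)) :
    CliffordAlgebra.reverse a = reverseSign q • a := by
  induction ha using Submodule.pow_induction_on_left' with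
  | algebraMap r => rw [CliffordAlgebra.reverse.commutes, reverseSign, one_smul]
  | add x y i _ _ hx hy => rw [map_add, hx, hy, smul_add]
  | mem_mul w hw i x hx' hx =>
    obtain ⟨u, rfl⟩ := hw
    rw [CliffordAlgebra.reverse.map_mul, hx, CliffordAlgebra.reverse_ι, smul_mul_assoc,
      mul_ι_of_mem hx', reverseSign, smul_smul, mul_comm (reverseSign i)]

/-- In fixed degree the antiautomorphism `tilde` is a sign times the algebra homomorphism
`twistHom`. The latter extends multiplicatively to superpolynomials, which makes `T` easy to
construct. -/
theorem tilde_of_mem {q : ℕ} {a : Grassmann n} (ha : a ∈ ⋀[ℂ]^q (Fin (2 * n) → ℂ)) :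
    tilde n a = reverseSign q • twistHom n a :=
  reverse_of_mem (twistHom_mem ha)

end GrassmannFacts

/-! ### Conjugation by the fermionic Gaussian -/

/-- This is `exp(X/2) Y exp(-X/2) = Y - 2H + X`, with the exponential series truncated by
nilpotency. -/
theorem SlTriple.lower_exp {V : Type*} [AddCommGroup V] [Module ℂ V] {X Y H : Module.End ℂ V}
    (t : SlTriple X Y H) {N : ℕ} (hN : X ^ (N + 1) = 0) (v : V) :
    Y (∑ j ∈ Finset.range (N + 1), ((-1 : ℂ) ^ j / (2 ^ j * (j.factorial : ℂ))) • (X ^ j) v)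
      = ∑ j ∈ Finset.range (N + 1),
        ((-1 : ℂ) ^ j / (2 ^ j * (j.factorial : ℂ))) • (X ^ j) (Y v - (2 : ℂ) • H v + X v) := by
  set c : ℕ → ℂ := fun j => (-1 : ℂ) ^ j / (2 ^ j * (j.factorial : ℂ)) with hc
  have hcs : ∀ j : ℕ, c (j + 1) * (j + 1) = -(1 / 2) * c j := by
    intro j
    have h1 : (j.factorial : ℂ) ≠ 0 := Nat.cast_ne_zero.2 j.factorial_ne_zero
    have h2 : (j + 1 : ℂ) ≠ 0 := Nat.cast_add_one_ne_zero j
    simp only [hc, pow_succ, Nat.factorial_succ]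
    push_cast
    field_simp
  have hcj : ∀ j : ℕ, (-1 : ℂ) ^ j / (2 ^ j * (j.factorial : ℂ)) = c j := fun _ => rfl
  have hz : ∀ u : V, (X ^ (N + 1)) u = 0 := fun u => by rw [hN]; rfl
  -- The top term vanishes, so the sum may be reindexed to powers `X ^ (j + 1)`, to which
  -- `lower_raise_pow` applies.
  have e1 : ∑ j ∈ Finset.range (N + 1), c j • (X ^ j) v
      = c 0 • v + ∑ j ∈ Finset.range (N + 1), c (j + 1) • (X ^ (j + 1)) v := by
    have := Finset.sum_range_succ' (fun j => c j • (X ^ j) v) (N + 1)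
    rw [Finset.sum_range_succ, hz, smul_zero, add_zero] at this
    rw [this, add_comm]
    simp
  have e2 : ∑ j ∈ Finset.range (N + 1), c j • (X ^ j) (Y v)
      = c 0 • Y v + ∑ j ∈ Finset.range (N + 1), c (j + 1) • (X ^ (j + 1)) (Y v) := by
    have := Finset.sum_range_succ' (fun j => c j • (X ^ j) (Y v)) (N + 1)
    rw [Finset.sum_range_succ, hz, smul_zero, add_zero] at this
    rw [this, add_comm]
    simp
  -- The recursion `(j + 1) c (j + 1) = -c j / 2` of the exponential coefficients turns the weight
  -- `-2j` into one extra factor `X`.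
  have e3 : ∑ j ∈ Finset.range (N + 1), (-2 * j * c j) • (X ^ j) v
      = ∑ j ∈ Finset.range (N + 1), c j • (X ^ j) (X v) := by
    rw [Finset.sum_range_succ', Finset.sum_range_succ, ← Module.End.mul_apply, ← pow_succ, hz]
    simp only [Nat.cast_zero, mul_zero, zero_mul, zero_smul, add_zero, smul_zero]
    refine Finset.sum_congr rfl fun j _ => ?_
    rw [← Module.End.mul_apply, ← pow_succ]
    congr 1
    push_cast
    linear_combination -2 * hcs j
  simp only [hcj, map_add, map_sub, map_smul, smul_add, smul_sub, Finset.sum_add_distrib,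
    Finset.sum_sub_distrib]
  rw [e1, map_add, map_sum, ← e3, e2, map_smul, add_sub_assoc, add_assoc]
  congr 1
  rw [← add_sub_right_comm, add_sub_assoc, ← Finset.sum_sub_distrib, ← Finset.sum_add_distrib]
  refine Finset.sum_congr rfl fun j _ => ?_
  rw [map_smul, t.lower_raise_pow, smul_add, smul_smul,
    show c (j + 1) * (4 * (j + 1)) = -2 * c j by linear_combination 4 * hcs j, map_add, map_smul]
  module

section GrassmannFacts

variable {n : ℕ}

theorem mul_gaussF (a : Grassmann n) :
    a * gaussF n = ∑ j ∈ Finset.range (n + 1),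
      ((-1 : ℂ) ^ j / (2 ^ j * (j.factorial : ℂ))) • (LinearMap.mulLeft ℂ (theta2 n) ^ j) a := by
  simp only [gaussF, Finset.mul_sum, mul_smul_comm, mulLeft_theta2_pow]
  exact Finset.sum_congr rfl fun j _ => by rw [((commute_theta2 a).pow_left j).eq]

theorem lapF_mul_gaussF (a : Grassmann n) :
    lapF n (a * gaussF n)
      = (lapF n a - (2 : ℂ) • (eulerF n - (n : ℂ) • 1 : Module.End ℂ (Grassmann n)) a
          + theta2 n * a) * gaussF n := by
  rw [mul_gaussF, mul_gaussF, slTriple_grassmann.lower_exp]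
  · rfl
  · rw [LinearMap.pow_mulLeft, theta2_pow_eq_zero, LinearMap.mulLeft_zero_eq_zero]

theorem isUnit_gaussF : IsUnit (gaussF n) := by
  rw [gaussF, Finset.sum_range_succ']
  simp only [pow_zero, Nat.factorial_zero, Nat.cast_one, mul_one, div_one, one_smul]
  refine IsNilpotent.isUnit_add_one ?_
  refine Commute.isNilpotent_sum (fun j _ => ?_) fun i j _ _ => ?_
  · exact (isNilpotent_theta2.pow_succ j).smul _
  · exact (((Commute.refl (theta2 n)).pow_pow _ _).smul_left _).smul_right _

/-! ### Complex conjugation -/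

theorem gConj_ι_mul (v : Fin (2 * n) → ℂ) (a : Grassmann n) :
    gConj n (ExteriorAlgebra.ι ℂ v * a)
      = ExteriorAlgebra.ι ℂ (fun k => starRingEnd ℂ (v k)) * gConj n a := by
  rw [gConj_mul]
  congr 1
  exact ExteriorAlgebra.lift_ι_apply ℂ (conjGen n) _ v

theorem gConj_gDeriv (k : Fin (2 * n)) (a : Grassmann n) :
    gConj n (gDeriv k a) = gDeriv k (gConj n a) := by
  induction a using grassmann_induction with
  | h1 => rw [gDeriv_one, gConj_one, gDeriv_one, map_zero]
  | hadd x y hx hy => simp only [map_add, hx, hy]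
  | hsmul c x hx => rw [map_smul, map_smulₛₗ, hx, map_smulₛₗ, map_smul]
  | hmul v x hx => rw [gDeriv_ι_mul, map_sub, map_smulₛₗ, gConj_ι_mul, gConj_ι_mul, gDeriv_ι_mul, hx]

theorem gConj_lapF (a : Grassmann n) : gConj n (lapF n a) = lapF n (gConj n a) := by
  simp only [lapF, LinearMap.smul_apply, LinearMap.sum_apply, Module.End.mul_apply, map_smulₛₗ,
    map_sum, gConj_gDeriv]
  simp [Complex.conj_ofNat]

theorem gConj_theta2 : gConj n (theta2 n) = theta2 n := by
  simp only [theta2, map_neg, map_sum, gConj_mul, gConj_gen]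

theorem gConj_gaussF : gConj n (gaussF n) = gaussF n := by
  have h : ∀ j, gConj n (theta2 n ^ j) = theta2 n ^ j := by
    intro j
    induction j with
    | zero => rw [pow_zero, gConj_one]
    | succ j ih => rw [pow_succ, gConj_mul, ih, gConj_theta2]
  simp only [gaussF, map_sum, map_smulₛₗ, h]
  simp [Complex.conj_ofNat]

/-! ### The Berezin integral -/

theorem gDeriv_mul (k : Fin (2 * n)) (a b : Grassmann n) :
    gDeriv k (a * b) = gDeriv k a * b + CliffordAlgebra.involute a * gDeriv k b := by
  induction a using grassmann_induction with
  | h1 => simp [gDeriv_one]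
  | hadd x y hx hy => simp only [map_add, add_mul, hx, hy]; abel
  | hsmul c x hx => simp only [map_smul, smul_mul_assoc, hx, smul_add]
  | hmul v x hx =>
    rw [mul_assoc, gDeriv_ι_mul, hx, gDeriv_ι_mul, map_mul, CliffordAlgebra.involute_ι,
      mul_add, sub_mul, smul_mul_assoc, neg_mul, neg_mul, mul_assoc, mul_assoc]
    abel

theorem involute_gDeriv (k : Fin (2 * n)) (a : Grassmann n) :
    CliffordAlgebra.involute (gDeriv k a) = -gDeriv k (CliffordAlgebra.involute a) := by
  induction a using grassmann_induction with
  | h1 => simp [gDeriv_one]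
  | hadd x y hx hy => simp only [map_add, hx, hy, neg_add]
  | hsmul c x hx => simp only [map_smul, hx, smul_neg]
  | hmul v x hx =>
    rw [gDeriv_ι_mul, map_sub, map_smul, map_mul, CliffordAlgebra.involute_ι, hx, map_mul,
      CliffordAlgebra.involute_ι, neg_mul, neg_mul, map_neg, gDeriv_ι_mul]
    simp

/-- Anticommute the extra derivative leftwards to the last occurrence of the same derivative in the
list; its square is zero. Hence the Berezin integral of a derivative vanishes. -/
theorem list_prod_gDeriv_mul (l : List (Fin (2 * n))) {k : Fin (2 * n)} (hk : k ∈ l) :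
    (l.map fun i => gDeriv (n := n) i).prod * gDeriv k = 0 := by
  induction l with
  | nil => simp at hk
  | cons i l ih =>
    rw [List.map_cons, List.prod_cons, mul_assoc]
    by_cases hkl : k ∈ l
    · rw [ih hkl, mul_zero]
    · obtain rfl : k = i := by simpa [hkl] using hk
      have h : ∀ l : List (Fin (2 * n)), (l.map fun i => gDeriv (n := n) i).prod * gDeriv k
          = ((-1 : ℂ) ^ l.length) • (gDeriv k * (l.map fun i => gDeriv (n := n) i).prod) := by
        intro l
        induction l with
        | nil => simp
        | cons i l ih =>
          rw [List.map_cons, List.prod_cons, mul_assoc, ih, mul_smul_comm, List.length_cons,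
            pow_succ, mul_smul, neg_one_smul]
          congr 1
          exact LinearMap.ext fun a => gDeriv_gDeriv_swap _ _ _
      rw [h, mul_smul_comm, ← mul_assoc, gDeriv_mul_self, zero_mul, smul_zero]

theorem berezin_gDeriv (k : Fin (2 * n)) (a : Grassmann n) : berezin n (gDeriv k a) = 0 := by
  have h : (List.ofFn (fun k : Fin (2 * n) => gDeriv (n := n) k)).reverse.prod * gDeriv k = 0 := by
    have := list_prod_gDeriv_mul (n := n) (List.finRange (2 * n)).reverse (k := k) (by simp)
    rwa [List.map_reverse, ← List.ofFn_eq_map] at this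
  have h' := congr($h a)
  rw [Module.End.mul_apply] at h'
  simp only [berezin, LinearMap.smul_apply, LinearMap.comp_apply, h']
  simp

theorem berezin_gDeriv_mul (k : Fin (2 * n)) (a b : Grassmann n) :
    berezin n (gDeriv k a * b) = -berezin n (CliffordAlgebra.involute a * gDeriv k b) := by
  have h := congrArg (berezin n) (gDeriv_mul k a b)
  rw [berezin_gDeriv, map_add] at h
  exact eq_neg_of_add_eq_zero_left h.symm

/-- Four signs cancel: two integrations by parts, one interchange of a derivative with the grading
involution, and one swap of two derivatives. -/
theorem berezin_lapF_mul (a b : Grassmann n) :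
    berezin n (lapF n a * b) = berezin n (a * lapF n b) := by
  simp only [lapF, LinearMap.smul_apply, LinearMap.sum_apply, Module.End.mul_apply, map_smul,
    map_sum, smul_mul_assoc, mul_smul_comm, Finset.sum_mul, Finset.mul_sum]
  congr 1
  refine Finset.sum_congr rfl fun j _ => ?_
  rw [berezin_gDeriv_mul, involute_gDeriv, neg_mul, map_neg, neg_neg, berezin_gDeriv_mul,
    CliffordAlgebra.involute_involute, gDeriv_gDeriv_swap, mul_neg, map_neg, neg_neg]

end GrassmannFacts

/-! ### Polynomials in the commuting variables -/

section Polynomials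

variable (m : ℕ)

/-- The Laplace operator on polynomials. -/
def lapB : Module.End ℂ (MvPolynomial (Fin m) ℂ) :=
  ∑ i : Fin m, (MvPolynomial.pderiv i).toLinearMap ∘ₗ (MvPolynomial.pderiv i).toLinearMap

/-- The Euler operator on polynomials, shifted by `m / 2`. -/
def weightB : Module.End ℂ (MvPolynomial (Fin m) ℂ) :=
  (∑ i : Fin m, LinearMap.mulLeft ℂ (MvPolynomial.X i) * (MvPolynomial.pderiv i).toLinearMap)
    + ((m : ℂ) / 2) • 1

/-- `r²` as a polynomial. -/
def normSqB : MvPolynomial (Fin m) ℂ := ∑ i : Fin m, MvPolynomial.X i ^ 2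

theorem slTriple_poly :
    SlTriple (LinearMap.mulLeft ℂ (normSqB m)) (lapB m) (weightB m) := by
  have h := SlTriple.of_weyl (fun i : Fin m => LinearMap.mulLeft ℂ (MvPolynomial.X (R := ℂ) i))
    (fun i : Fin m => (MvPolynomial.pderiv (R := ℂ) i).toLinearMap) ?_ ?_
  · have e : LinearMap.mulLeft ℂ (normSqB m) = ∑ i : Fin m,
        LinearMap.mulLeft ℂ (MvPolynomial.X (R := ℂ) i) * LinearMap.mulLeft ℂ (MvPolynomial.X i) := by
      refine LinearMap.ext fun p => ?_
      simp [normSqB, Finset.sum_mul, pow_two, mul_assoc]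
    rw [e, lapB, weightB]
    rwa [Fintype.card_fin] at h
  · intro i j
    refine LinearMap.ext fun p => ?_
    simp [mul_left_comm]
  · intro i j
    refine LinearMap.ext fun p => ?_
    rcases eq_or_ne i j with rfl | hij
    · simp [add_comm, mul_comm]
    · simp [MvPolynomial.pderiv_X_of_ne hij.symm, hij]

variable {m}

theorem pderiv_eq_zero_of_isHomogeneous_zero {p : MvPolynomial (Fin m) ℂ}
    (hp : p.IsHomogeneous 0) (i : Fin m) : MvPolynomial.pderiv i p = 0 := by
  rw [MvPolynomial.totalDegree_eq_zero_iff_eq_C.1 (Nat.le_zero.1 hp.totalDegree_le),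
    MvPolynomial.pderiv_C]

theorem weightB_of_isHomogeneous {k : ℕ} {p : MvPolynomial (Fin m) ℂ} (hp : p.IsHomogeneous k) :
    weightB m p = ((k : ℂ) + (m : ℂ) / 2) • p := by
  have h := hp.sum_X_mul_pderiv
  rw [weightB, LinearMap.add_apply, LinearMap.sum_apply, add_smul]
  congr 1
  rw [Nat.cast_smul_eq_nsmul, ← h]
  rfl

theorem le_fischer_poly (hm : 0 < m) (k : ℕ) :
    MvPolynomial.homogeneousSubmodule (Fin m) ℂ k ≤
      SlTriple.fischer (LinearMap.mulLeft ℂ (normSqB m)) (lapB m)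
        (MvPolynomial.homogeneousSubmodule (Fin m) ℂ) k := by
  induction k using Nat.twoStepInduction with
  | zero =>
    refine SlTriple.le_fischer_of_ker fun p hp => ?_
    simp [lapB, pderiv_eq_zero_of_isHomogeneous_zero hp]
  | one =>
    refine SlTriple.le_fischer_of_ker fun p hp => ?_
    have hp' : p.IsHomogeneous 1 := hp
    simp [lapB, pderiv_eq_zero_of_isHomogeneous_zero hp'.pderiv]
  | more k ih _ =>
    refine SlTriple.le_fischer_add_two (slTriple_poly m) (c := (m : ℂ) / 2)
      (fun q p hp => weightB_of_isHomogeneous hp) (fun q p hp => ?_) (fun q p hp => ?_) ih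
      fun j q _ h0 => ?_
    · have hr : (normSqB m).IsHomogeneous 2 :=
        MvPolynomial.IsHomogeneous.sum _ _ _ fun i _ => by
          simpa using (MvPolynomial.isHomogeneous_X ℂ i).pow 2
      have := hr.mul hp
      rwa [add_comm] at this
    · have hp' : p.IsHomogeneous (q + 2) := hp
      rw [lapB, LinearMap.sum_apply]
      exact sum_mem fun i _ => hp'.pderiv.pderiv
    · have h1 : ((2 * q + m + 2 * j : ℕ) : ℂ) = 0 := by
        push_cast
        linear_combination 2 * h0
      have := Nat.cast_eq_zero.1 h1
      omega

/-- The bosonic Fischer decomposition. -/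
theorem span_normSqB_pow_mul_harmonic (hm : 0 < m) :
    Submodule.span ℂ {u : MvPolynomial (Fin m) ℂ | ∃ j p, ∃ h ∈ harmonicB m p,
      u = normSqB m ^ j * h} = ⊤ := by
  refine eq_top_iff.2 fun a _ => ?_
  rw [← MvPolynomial.sum_homogeneousComponent a]
  refine sum_mem fun k _ => ?_
  refine (Submodule.span_le.2 ?_ : _ ≤ _)
    (le_fischer_poly hm k (MvPolynomial.homogeneousComponent_mem k a))
  rintro _ ⟨j, q, -, h, hh, hY, rfl⟩
  exact Submodule.subset_span ⟨j, q, h, ⟨hh, hY⟩, by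
    rw [LinearMap.pow_mulLeft, LinearMap.mulLeft_apply]⟩

end Polynomials

/-! ### Smooth functions and the bosonic Gaussian -/

section Smooth

variable {m : ℕ}

theorem bDeriv_mul (i : Fin m) (f g : smooth m) :
    bDeriv i (f * g) = bDeriv i f * g + f * bDeriv i g := by
  have hf : ContDiff ℝ ∞ f.1 := f.2
  have hg : ContDiff ℝ ∞ g.1 := g.2
  ext x
  change fderiv ℝ (f.1 * g.1) x _ = fderiv ℝ f.1 x _ * g.1 x + f.1 x * fderiv ℝ g.1 x _
  rw [fderiv_mul (hf.differentiable (by simp) x) (hg.differentiable (by simp) x)]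
  simp only [_root_.add_apply, _root_.smul_apply, smul_eq_mul]
  ring

theorem bDeriv_coord (i j : Fin m) : bDeriv i (coord j) = if i = j then 1 else 0 := by
  ext x
  change fderiv ℝ (fun x : EuclideanSpace ℝ (Fin m) => ((x j : ℝ) : ℂ)) x _ = _
  have h : HasFDerivAt (fun x : EuclideanSpace ℝ (Fin m) => ((x j : ℝ) : ℂ))
      (Complex.ofRealCLM.comp (EuclideanSpace.proj (𝕜 := ℝ) j)) x :=
    (Complex.ofRealCLM.comp (EuclideanSpace.proj (𝕜 := ℝ) j)).hasFDerivAt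
  rw [h.fderiv]
  split_ifs with hij
  · subst hij
    simp
  · simp [Ne.symm hij]

theorem bDeriv_gaussB (i : Fin m) : bDeriv i (gaussB m) = -(coord i * gaussB m) := by
  ext x
  change fderiv ℝ (fun x : EuclideanSpace ℝ (Fin m) =>
    ((Real.exp (-(∑ i, x i ^ 2) / 2) : ℝ) : ℂ)) x _ = -(((x i : ℝ) : ℂ) * ((Real.exp _ : ℝ) : ℂ))
  have h1 : HasFDerivAt (fun x : EuclideanSpace ℝ (Fin m) => -(∑ i, x i ^ 2) / 2)
      (-(∑ i, x i • (EuclideanSpace.proj (𝕜 := ℝ) i : EuclideanSpace ℝ (Fin m) →L[ℝ] ℝ))) x := by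
    have h2 : HasFDerivAt (fun x : EuclideanSpace ℝ (Fin m) => ∑ i, x i ^ 2)
        (∑ i, (2 * x i) • (EuclideanSpace.proj (𝕜 := ℝ) i : EuclideanSpace ℝ (Fin m) →L[ℝ] ℝ)) x :=
      HasFDerivAt.fun_sum fun j _ => by
        simpa using ((EuclideanSpace.proj (𝕜 := ℝ) j :
          EuclideanSpace ℝ (Fin m) →L[ℝ] ℝ).hasFDerivAt (x := x)).pow 2
    have h3 := h2.neg.mul_const (2⁻¹ : ℝ)
    simp only [div_eq_mul_inv]
    refine h3.congr_fderiv ?_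
    ext y
    simp only [mul_assoc, neg_apply, smul_neg, _root_.smul_apply, _root_.sum_apply, smul_eq_mul,
      ← Finset.mul_sum]
    ring
  have h4 := (Complex.ofRealCLM.hasFDerivAt (x := Real.exp (-(∑ i, x i ^ 2) / 2))).comp x h1.exp
  have h5 : fderiv ℝ (fun x : EuclideanSpace ℝ (Fin m) =>
    ((Real.exp (-(∑ i, x i ^ 2) / 2) : ℝ) : ℂ)) x = _ := h4.fderiv
  rw [h5]
  simp [mul_comm]

theorem bDeriv_one (i : Fin m) : bDeriv i (1 : smooth m) = 0 := by
  have h := bDeriv_mul i (1 : smooth m) 1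
  simpa using h

theorem bDeriv_aeval (i : Fin m) (p : MvPolynomial (Fin m) ℂ) :
    bDeriv i (MvPolynomial.aeval coord p) = MvPolynomial.aeval coord (MvPolynomial.pderiv i p) := by
  induction p using MvPolynomial.induction_on with
  | C a =>
    rw [MvPolynomial.aeval_C, MvPolynomial.pderiv_C, map_zero, Algebra.algebraMap_eq_smul_one,
      map_smul, bDeriv_one, smul_zero]
  | add p q hp hq => simp only [map_add, hp, hq]
  | mul_X p j hp =>
    rw [map_mul, bDeriv_mul, hp, MvPolynomial.aeval_X, bDeriv_coord, Derivation.leibniz, map_add,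
      MvPolynomial.pderiv_X, smul_eq_mul, smul_eq_mul, map_mul, map_mul, MvPolynomial.aeval_X,
      Pi.single_apply]
    split_ifs with h h' h'
    · simp [mul_comm, add_comm]
    · exact absurd h.symm h'
    · exact absurd h'.symm h
    · simp [mul_comm]

theorem bDeriv_aeval_mul_gaussB (i : Fin m) (p : MvPolynomial (Fin m) ℂ) :
    bDeriv i (MvPolynomial.aeval coord p * gaussB m)
      = MvPolynomial.aeval coord (MvPolynomial.pderiv i p - MvPolynomial.X i * p) * gaussB m := by
  rw [bDeriv_mul, bDeriv_aeval, bDeriv_gaussB, map_sub, map_mul, MvPolynomial.aeval_X]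
  ring

/-- Bosonic counterpart of `lapF_mul_gaussF`. Since `r²` is not nilpotent, it is obtained by
expanding `∑ (∂ᵢ - xᵢ)²`. -/
theorem lapB_aeval_mul_gaussB (p : MvPolynomial (Fin m) ℂ) :
    (∑ i : Fin m, bDeriv i * bDeriv i) (MvPolynomial.aeval coord p * gaussB m)
      = MvPolynomial.aeval coord (lapB m p - (2 : ℂ) • weightB m p + normSqB m * p)
        * gaussB m := by
  simp only [LinearMap.sum_apply, Module.End.mul_apply, bDeriv_aeval_mul_gaussB]
  rw [← Finset.sum_mul, ← map_sum]
  congr 2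
  have h : ∀ i : Fin m, MvPolynomial.pderiv i (MvPolynomial.pderiv i p - MvPolynomial.X i * p)
      - MvPolynomial.X i * (MvPolynomial.pderiv i p - MvPolynomial.X i * p)
      = MvPolynomial.pderiv i (MvPolynomial.pderiv i p)
        - ((2 : ℂ) • (MvPolynomial.X i * MvPolynomial.pderiv i p) + p)
        + MvPolynomial.X i ^ 2 * p := by
    intro i
    rw [map_sub, MvPolynomial.pderiv_mul, MvPolynomial.pderiv_X_self, two_smul]
    ring
  simp only [h, Finset.sum_add_distrib, Finset.sum_sub_distrib, ← Finset.sum_mul,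
    ← Finset.smul_sum, Finset.sum_const, Finset.card_univ, Fintype.card_fin,
    ← Nat.cast_smul_eq_nsmul ℂ]
  simp only [lapB, weightB, normSqB, LinearMap.add_apply, LinearMap.sum_apply, LinearMap.comp_apply,
    Module.End.mul_apply, LinearMap.smul_apply, Module.End.one_apply, LinearMap.mulLeft_apply,
    Derivation.coeFn_coe, smul_add, smul_smul]
  congr 3
  congr 1
  ring

theorem isUnit_gaussB : IsUnit (gaussB m) := by
  refine IsUnit.of_mul_eq_one (⟨fun x => ((Real.exp ((∑ i, x i ^ 2) / 2) : ℝ) : ℂ), ?_⟩) ?_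
  · change ContDiff ℝ ∞ _
    refine Complex.ofRealCLM.contDiff.comp (Real.contDiff_exp.comp (ContDiff.div_const
      (ContDiff.sum fun i _ => ?_) _))
    exact (EuclideanSpace.proj (𝕜 := ℝ) i).contDiff.pow 2
  · ext x
    change ((Real.exp (-(∑ i, x i ^ 2) / 2) : ℝ) : ℂ) * ((Real.exp ((∑ i, x i ^ 2) / 2) : ℝ) : ℂ) = 1
    rw [← Complex.ofReal_mul, ← Real.exp_add, neg_div, neg_add_cancel, Real.exp_zero,
      Complex.ofReal_one]

theorem aeval_coord_apply (p : MvPolynomial (Fin m) ℂ) (x : EuclideanSpace ℝ (Fin m)) :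
    (MvPolynomial.aeval coord p : smooth m).1 x = MvPolynomial.eval (fun i => ((x i : ℝ) : ℂ)) p := by
  induction p using MvPolynomial.induction_on with
  | C a => rw [MvPolynomial.aeval_C, MvPolynomial.eval_C]; rfl
  | add p q hp hq => rw [map_add, map_add, ← hp, ← hq]; rfl
  | mul_X p j hp =>
    rw [map_mul, map_mul, ← hp, MvPolynomial.aeval_X, MvPolynomial.eval_X]
    rfl

/-- A complex polynomial that vanishes at all real points is zero, because `ℝ` is an infinite subset
of `ℂ`. -/
theorem aeval_coord_injective :
    Function.Injective (MvPolynomial.aeval (R := ℂ) (coord (m := m))) := by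
  intro p q hpq
  refine MvPolynomial.funext_set (fun _ => Set.range ((↑) : ℝ → ℂ))
    (fun _ => Set.infinite_range_of_injective Complex.ofReal_injective) fun x hx => ?_
  choose y hy using fun i => hx i trivial
  obtain rfl : (fun i => ((y i : ℝ) : ℂ)) = x := funext hy
  have h := congrArg (fun f : smooth m => f.1 (WithLp.toLp 2 y)) hpq
  simpa only [aeval_coord_apply] using h

theorem slTriple_smooth :
    SlTriple (LinearMap.mulLeft ℂ (∑ i : Fin m, coord i ^ 2)) (∑ i : Fin m, bDeriv i * bDeriv i)
      ((∑ i : Fin m, LinearMap.mulLeft ℂ (coord i) * bDeriv i) + ((m : ℂ) / 2) • 1) := by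
  have h := SlTriple.of_weyl (fun i : Fin m => LinearMap.mulLeft ℂ (coord i))
    (fun i : Fin m => bDeriv i) ?_ ?_
  · have e : LinearMap.mulLeft ℂ (∑ i : Fin m, coord i ^ 2) = ∑ i : Fin m,
        LinearMap.mulLeft ℂ (coord i) * LinearMap.mulLeft ℂ (coord i) := by
      refine LinearMap.ext fun p => ?_
      simp only [LinearMap.sum_apply, Module.End.mul_apply, LinearMap.mulLeft_apply,
        Finset.sum_mul, pow_two, mul_assoc]
    rw [e]
    rwa [Fintype.card_fin] at h
  · intro i j
    refine LinearMap.ext fun p => ?_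
    exact mul_left_comm _ _ _
  · intro i j
    refine LinearMap.ext fun p => ?_
    rw [Module.End.mul_apply, LinearMap.mulLeft_apply, bDeriv_mul, bDeriv_coord]
    split_ifs with hij
    · rw [one_mul, add_comm]
      rfl
    · rw [zero_mul, zero_add, add_zero]
      rfl

theorem bConj_mul (f g : smooth m) : bConj m (f * g) = bConj m f * bConj m g := by
  ext x
  exact map_mul (starRingEnd ℂ) (f.1 x) (g.1 x)

theorem bConj_coord (i : Fin m) : bConj m (coord i) = coord i := by
  ext x
  exact Complex.conj_ofReal _

theorem bConj_gaussB : bConj m (gaussB m) = gaussB m := by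
  ext x
  exact Complex.conj_ofReal _

theorem bConj_bDeriv (i : Fin m) (f : smooth m) : bConj m (bDeriv i f) = bDeriv i (bConj m f) := by
  have hf : ContDiff ℝ ∞ f.1 := f.2
  ext x
  have h := (Complex.conjCLE.toContinuousLinearMap.hasFDerivAt (x := f.1 x)).comp x
    (hf.differentiable (by simp) x).hasFDerivAt
  exact (congr($(h.fderiv) (EuclideanSpace.single i 1))).symm

theorem bConj_aeval (p : MvPolynomial (Fin m) ℂ) :
    bConj m (MvPolynomial.aeval coord p)
      = MvPolynomial.aeval coord (MvPolynomial.map (starRingEnd ℂ) p) := by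
  induction p using MvPolynomial.induction_on with
  | C a => rw [MvPolynomial.map_C, MvPolynomial.aeval_C, MvPolynomial.aeval_C]; rfl
  | add p q hp hq => simp only [map_add, hp, hq]
  | mul_X p j hp =>
    rw [map_mul, bConj_mul, hp, map_mul, map_mul, MvPolynomial.map_X, MvPolynomial.aeval_X,
      bConj_coord]

end Smooth

/-! ### The coefficients of the harmonic polynomials `f_{k,p,q}` -/

/-- The falling factorial `x (x - 1) ⋯ (x - k + 1)`. -/
def fallingFactorial (k : ℕ) (x : ℝ) : ℝ := ∏ i ∈ Finset.range k, (x - i)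

theorem fallingFactorial_succ (k : ℕ) (x : ℝ) :
    fallingFactorial (k + 1) x = fallingFactorial k x * (x - k) :=
  Finset.prod_range_succ _ _

/-- The Chu–Vandermonde identity. -/
theorem fallingFactorial_add (k : ℕ) (x y : ℝ) :
    fallingFactorial k (x + y) = ∑ s ∈ Finset.HasAntidiagonal.antidiagonal k,
      k.choose s.1 • (fallingFactorial s.1 x * fallingFactorial s.2 y) := by
  induction k with
  | zero => simp [fallingFactorial]
  | succ k ih =>
    rw [Finset.sum_antidiagonal_choose_succ_nsmul
        (fun i j => fallingFactorial i x * fallingFactorial j y), fallingFactorial_succ, ih,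
      Finset.sum_mul, ← Finset.sum_add_distrib]
    refine Finset.sum_congr rfl fun s hs => ?_
    -- The new factor `x + y - k` is `(x - s.1) + (y - s.2)`; each summand extends one of the two
    -- falling factorials, as in Pascal's rule.
    have hk : (k : ℝ) = s.1 + s.2 := by exact_mod_cast (Finset.HasAntidiagonal.mem_antidiagonal.1 hs).symm
    have hc : k.choose s.2 = k.choose s.1 := by
      rw [← Finset.HasAntidiagonal.mem_antidiagonal.1 hs, Nat.choose_symm_add]
    rw [fallingFactorial_succ, fallingFactorial_succ, hk, hc, ← smul_add, smul_mul_assoc]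
    congr 1
    ring

theorem Gamma_eq_fallingFactorial_mul {x : ℝ} {s : ℕ} (hs : (s : ℝ) < x + 1) :
    Real.Gamma (x + 1) = fallingFactorial s x * Real.Gamma (x + 1 - s) := by
  induction s with
  | zero => simp [fallingFactorial]
  | succ s ih =>
    push_cast at hs
    rw [ih (by linarith), fallingFactorial_succ, show x + 1 - (s : ℝ) = (x - s) + 1 by ring,
      Real.Gamma_add_one (by linarith)]
    push_cast
    rw [show x + 1 - ((s : ℝ) + 1) = x - s by ring]
    ring

theorem factorial_eq_fallingFactorial_mul (l t : ℕ) :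
    ((l + t).factorial : ℝ) = (-1) ^ t * fallingFactorial t (-1 - l) * (l.factorial : ℝ) := by
  induction t with
  | zero => simp [fallingFactorial]
  | succ t ih =>
    rw [← add_assoc, Nat.factorial_succ, fallingFactorial_succ]
    push_cast
    rw [ih]
    ring

/-- The coefficient of `r^{2k-2s} θ^{2s}` in `f_{k,p,q}`. -/
def fCoeff (m n k p q s : ℕ) : ℝ :=
  (k.choose s : ℝ) * (((n - q - s).factorial : ℝ) / Real.Gamma ((m : ℝ) / 2 + p + k - s))
    * (Real.Gamma ((m : ℝ) / 2 + p + k) / ((n - q - k).factorial : ℝ))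

/-- Brings the coefficients into the shape of the summands of Chu–Vandermonde; the factorial
quotient becomes a falling factorial at a negative argument. -/
theorem fCoeff_eq {m n k p q s : ℕ} (hm : 0 < m) (hs : s ≤ k) (hk : k + q ≤ n) :
    fCoeff m n k p q s = (-1) ^ (k - s) * (k.choose s * (fallingFactorial s ((m : ℝ) / 2 + p + k - 1)
      * fallingFactorial (k - s) (-1 - (n - q - k : ℕ)))) := by
  have hm' : (0 : ℝ) < m := Nat.cast_pos.2 hm
  have hs' : (s : ℝ) ≤ k := Nat.cast_le.2 hs
  have hp : (0 : ℝ) ≤ p := Nat.cast_nonneg p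
  have h1 := Gamma_eq_fallingFactorial_mul (x := (m : ℝ) / 2 + p + k - 1) (s := s) (by linarith)
  have h2 := factorial_eq_fallingFactorial_mul (n - q - k) (k - s)
  rw [show n - q - k + (k - s) = n - q - s by omega] at h2
  rw [sub_add_cancel] at h1
  have h3 : Real.Gamma ((m : ℝ) / 2 + p + k - s) ≠ 0 := (Real.Gamma_pos_of_pos (by linarith)).ne'
  have h4 : ((n - q - k).factorial : ℝ) ≠ 0 := Nat.cast_ne_zero.2 (Nat.factorial_ne_zero _)
  rw [fCoeff, h1, h2]
  set G := Real.Gamma ((m : ℝ) / 2 + p + k - s)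
  field_simp

/-- The sum is the value of `f_{k,p,q}` at `r² = 1`, `θ² = -1`, where `R² = 0`. By Chu–Vandermonde
it is, up to sign, the product of `M/2 + p + q + 2k - 2 - i` over `i < k`, and these factors are
positive when `M > 0`. So `f_{k,p,q}`, as a polynomial in `r²` and `θ²`, is not divisible by `R²`.
-/
theorem sum_neg_one_pow_mul_fCoeff_ne_zero {m n k p q : ℕ} (hM : 2 * n < m) (hk : k + q ≤ n) :
    ∑ s ∈ Finset.range (k + 1), (-1) ^ s * fCoeff m n k p q s ≠ 0 := by
  have h : ∑ s ∈ Finset.range (k + 1), (-1) ^ s * fCoeff m n k p q s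
      = (-1) ^ k * fallingFactorial k
        (((m : ℝ) / 2 + p + k - 1) + (-1 - (n - q - k : ℕ))) := by
    rw [fallingFactorial_add, Finset.Nat.sum_antidiagonal_eq_sum_range_succ_mk, Finset.mul_sum]
    refine Finset.sum_congr rfl fun s hs => ?_
    have hs' : s ≤ k := Nat.lt_succ_iff.1 (Finset.mem_range.1 hs)
    rw [fCoeff_eq (by omega) hs' hk, ← mul_assoc, ← pow_add, Nat.add_sub_cancel' hs',
      nsmul_eq_mul]
  rw [h]
  refine mul_ne_zero (pow_ne_zero _ (by norm_num)) (Finset.prod_ne_zero_iff.2 fun i hi => ?_)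
  have hi' : (i : ℝ) + 1 ≤ k := by exact_mod_cast Finset.mem_range.1 hi
  have hM' : 2 * (n : ℝ) + 1 ≤ m := by exact_mod_cast hM
  have hp : (0 : ℝ) ≤ p := Nat.cast_nonneg p
  have hq : (0 : ℝ) ≤ q := Nat.cast_nonneg q
  have hk' : ((n - q - k : ℕ) : ℝ) = n - q - k := by
    rw [Nat.cast_sub (by omega), Nat.cast_sub (by omega)]
  rw [hk']
  apply ne_of_gt
  linarith

/-- The recursion that expresses harmonicity: the bosonic Laplacian of term `s` cancels the
fermionic Laplacian of term `s + 1`. -/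
theorem fCoeff_succ {m n k p q s : ℕ} (hm : 0 < m) (hs : s < k) (hk : k + q ≤ n) :
    fCoeff m n k p q s * ((k - s) * ((m : ℝ) / 2 + p + k - s - 1))
      = fCoeff m n k p q (s + 1) * ((s + 1) * (n - q - s)) := by
  have hm' : (0 : ℝ) < m := Nat.cast_pos.2 hm
  have hs' : (s : ℝ) + 1 ≤ k := by exact_mod_cast hs
  have hp : (0 : ℝ) ≤ p := Nat.cast_nonneg p
  have hx : (0 : ℝ) < (m : ℝ) / 2 + p + k - s - 1 := by linarith
  have h1 : ((n - q - s).factorial : ℝ) = (n - q - s) * ((n - q - (s + 1)).factorial : ℝ) := by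
    rw [show n - q - s = n - q - (s + 1) + 1 by omega, Nat.factorial_succ]
    push_cast [Nat.cast_sub (show s + 1 ≤ n - q by omega), Nat.cast_sub (show q ≤ n by omega)]
    ring
  have h2 : Real.Gamma ((m : ℝ) / 2 + p + k - s)
      = ((m : ℝ) / 2 + p + k - s - 1) * Real.Gamma ((m : ℝ) / 2 + p + k - s - 1) := by
    rw [← Real.Gamma_add_one hx.ne', sub_add_cancel]
  have h3 : (k.choose s : ℝ) * (k - s) = k.choose (s + 1) * (s + 1) := by
    have := Nat.choose_succ_right_eq k s
    have h : ((k.choose (s + 1) * (s + 1) : ℕ) : ℝ) = (k.choose s * (k - s) : ℕ) := by rw [this]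
    push_cast [Nat.cast_sub hs.le] at h
    exact h.symm
  have h4 := (Real.Gamma_pos_of_pos hx).ne'
  have h5 : (m : ℝ) / 2 + p + k - (s + 1 : ℕ) = (m : ℝ) / 2 + p + k - s - 1 := by
    push_cast
    ring
  rw [fCoeff, fCoeff, h1, h2, h5]
  set G := Real.Gamma ((m : ℝ) / 2 + p + k - s - 1)
  set x := (m : ℝ) / 2 + p + k - s - 1
  have h6 : (n - q - s : ℝ) * ((n - q - (s + 1)).factorial : ℝ) / (x * G) * x
      = (n - q - s) * ((n - q - (s + 1)).factorial / G) := by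
    field_simp
  calc _ = (k.choose s * (k - s) : ℝ)
        * ((n - q - s : ℝ) * ((n - q - (s + 1)).factorial : ℝ) / (x * G) * x)
        * (Real.Gamma ((m : ℝ) / 2 + p + k) / ((n - q - k).factorial : ℝ)) := by ring
    _ = _ := by
      rw [h6, h3]
      ring

/-! ### Superpolynomials -/

section SuperPolynomials

variable {m n : ℕ}

/-- The super Laplace operator on superpolynomials. -/
def lapP (m n : ℕ) : Module.End ℂ (SuperPoly m n) :=
  LinearMap.rTensor (Grassmann n) (lapB m)
    + LinearMap.lTensor (MvPolynomial (Fin m) ℂ) (lapF n)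

/-- The super Euler operator on superpolynomials, shifted by `M / 2`. -/
def weightP (m n : ℕ) : Module.End ℂ (SuperPoly m n) :=
  LinearMap.rTensor (Grassmann n) (weightB m)
    + LinearMap.lTensor (MvPolynomial (Fin m) ℂ) (eulerF n - (n : ℂ) • 1)

theorem r2_mul_tmul (p : MvPolynomial (Fin m) ℂ) (a : Grassmann n) :
    r2 m n * (p ⊗ₜ a) = (normSqB m * p) ⊗ₜ a := by
  rw [r2, Algebra.TensorProduct.tmul_mul_tmul, one_mul, normSqB]

theorem th2_mul_tmul (p : MvPolynomial (Fin m) ℂ) (a : Grassmann n) :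
    th2 m n * (p ⊗ₜ a) = p ⊗ₜ (theta2 n * a) := by
  rw [th2, Algebra.TensorProduct.tmul_mul_tmul, one_mul]

theorem R2_mul_tmul (p : MvPolynomial (Fin m) ℂ) (a : Grassmann n) :
    R2 m n * (p ⊗ₜ a) = (normSqB m * p) ⊗ₜ a + p ⊗ₜ (theta2 n * a) := by
  rw [R2, add_mul, r2_mul_tmul, th2_mul_tmul]

theorem slTriple_superPoly :
    SlTriple (LinearMap.mulLeft ℂ (R2 m n)) (lapP m n) (weightP m n) := by
  have e : LinearMap.mulLeft ℂ (R2 m n)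
      = LinearMap.rTensor (Grassmann n) (LinearMap.mulLeft ℂ (normSqB m))
        + LinearMap.lTensor (MvPolynomial (Fin m) ℂ) (LinearMap.mulLeft ℂ (theta2 n)) := by
    refine TensorProduct.ext' fun p a => ?_
    rw [LinearMap.mulLeft_apply, R2_mul_tmul]
    rfl
  rw [e]
  exact (slTriple_poly m).tensor slTriple_grassmann

theorem mulLeft_R2_pow (j : ℕ) (P : SuperPoly m n) :
    (LinearMap.mulLeft ℂ (R2 m n) ^ j) P = R2 m n ^ j * P := by
  rw [LinearMap.pow_mulLeft, LinearMap.mulLeft_apply]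

/-- `r^{2a} θ^{2b} h w`. -/
def radial (h : MvPolynomial (Fin m) ℂ) (w : Grassmann n) (a b : ℕ) : SuperPoly m n :=
  (normSqB m ^ a * h) ⊗ₜ (theta2 n ^ b * w)

variable {h : MvPolynomial (Fin m) ℂ} {w : Grassmann n}

theorem r2_mul_radial (a b : ℕ) : r2 m n * radial h w a b = radial h w (a + 1) b := by
  rw [radial, r2_mul_tmul, radial, pow_succ', mul_assoc]

theorem th2_mul_radial (a b : ℕ) : th2 m n * radial h w a b = radial h w a (b + 1) := by
  rw [radial, th2_mul_tmul, radial, pow_succ', mul_assoc]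

theorem R2_mul_radial (a b : ℕ) :
    R2 m n * radial h w a b = radial h w (a + 1) b + radial h w a (b + 1) := by
  rw [R2, add_mul, r2_mul_radial, th2_mul_radial]

theorem r2_pow_mul_th2_pow_mul_tmul (a b : ℕ) :
    r2 m n ^ a * th2 m n ^ b * (h ⊗ₜ w) = radial h w a b := by
  have h1 : th2 m n ^ b * (h ⊗ₜ w) = radial h w 0 b := by
    induction b with
    | zero => simp [radial]
    | succ b ih => rw [pow_succ', mul_assoc, ih, th2_mul_radial]
  rw [mul_assoc, h1]
  induction a with
  | zero => rw [pow_zero, one_mul]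
  | succ a ih => rw [pow_succ', mul_assoc, ih, r2_mul_radial]

theorem fPoly_mul_tmul (k p q : ℕ) :
    fPoly m n k p q * (h ⊗ₜ w)
      = ∑ s ∈ Finset.range (k + 1), ((fCoeff m n k p q s : ℝ) : ℂ) • radial h w (k - s) s := by
  rw [fPoly, Finset.sum_mul]
  exact Finset.sum_congr rfl fun s _ => by
    rw [smul_mul_assoc, r2_pow_mul_th2_pow_mul_tmul, fCoeff]

variable {p q : ℕ}

theorem weightB_radial (hh : h ∈ harmonicB m p) (a : ℕ) :
    weightB m (normSqB m ^ a * h) = ((p : ℂ) + (m : ℂ) / 2 + 2 * a) • (normSqB m ^ a * h) := by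
  have := (slTriple_poly m).weight_raise_pow_of_eigen a (weightB_of_isHomogeneous hh.1)
  rwa [LinearMap.pow_mulLeft] at this

theorem weightF_radial (hw : w ∈ harmonicF n q) (b : ℕ) :
    (eulerF n - (n : ℂ) • 1 : Module.End ℂ (Grassmann n)) (theta2 n ^ b * w)
      = ((q : ℂ) + -(n : ℂ) + 2 * b) • (theta2 n ^ b * w) := by
  have := slTriple_grassmann.weight_raise_pow_of_eigen b (weightF_of_mem hw.1)
  rwa [LinearMap.pow_mulLeft] at this

theorem weightP_radial (hh : h ∈ harmonicB m p) (hw : w ∈ harmonicF n q) (a b : ℕ) :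
    weightP m n (radial h w a b)
      = ((p : ℂ) + q + (m : ℂ) / 2 - n + 2 * (a + b)) • radial h w a b := by
  rw [weightP, radial, LinearMap.add_apply, LinearMap.rTensor_tmul, LinearMap.lTensor_tmul,
    weightB_radial hh, weightF_radial hw, ← TensorProduct.smul_tmul', TensorProduct.tmul_smul]
  module

theorem weightP_fPoly_mul (hh : h ∈ harmonicB m p) (hw : w ∈ harmonicF n q) (k : ℕ) :
    weightP m n (fPoly m n k p q * (h ⊗ₜ w))
      = ((p : ℂ) + q + (m : ℂ) / 2 - n + 2 * k) • (fPoly m n k p q * (h ⊗ₜ w)) := by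
  rw [fPoly_mul_tmul, map_sum, Finset.smul_sum]
  refine Finset.sum_congr rfl fun s hs => ?_
  have hs' : s ≤ k := Nat.lt_succ_iff.1 (Finset.mem_range.1 hs)
  rw [map_smul, weightP_radial hh hw, smul_comm, Nat.cast_sub hs', sub_add_cancel]

theorem lapB_radial (hh : h ∈ harmonicB m p) (a : ℕ) :
    lapB m (normSqB m ^ (a + 1) * h)
      = (4 * (a + 1) * ((p : ℂ) + (m : ℂ) / 2 + a)) • (normSqB m ^ a * h) := by
  have := (slTriple_poly m).lower_raise_pow_of_ker a (weightB_of_isHomogeneous hh.1) hh.2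
  rwa [LinearMap.pow_mulLeft, LinearMap.pow_mulLeft] at this

theorem lapF_radial (hw : w ∈ harmonicF n q) (b : ℕ) :
    lapF n (theta2 n ^ (b + 1) * w)
      = (4 * (b + 1) * ((q : ℂ) + -(n : ℂ) + b)) • (theta2 n ^ b * w) := by
  have := slTriple_grassmann.lower_raise_pow_of_ker b (weightF_of_mem hw.1) hw.2
  rwa [LinearMap.pow_mulLeft, LinearMap.pow_mulLeft] at this

/-- The polynomials `f_{k,p,q} H^b_p H^f_q` are harmonic. -/
theorem lapP_fPoly_mul (hm : 0 < m) (hh : h ∈ harmonicB m p) (hw : w ∈ harmonicF n q) {k : ℕ}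
    (hk : k + q ≤ n) : lapP m n (fPoly m n k p q * (h ⊗ₜ w)) = 0 := by
  have hB : lapB m h = 0 := hh.2
  have hF : lapF n w = 0 := hw.2
  -- The bosonic sum loses its last term and the fermionic sum its first, both being killed by
  -- harmonicity; the remaining terms are matched `s` with `s + 1`.
  rw [fPoly_mul_tmul, lapP, LinearMap.add_apply, map_sum, map_sum, Finset.sum_range_succ,
    Finset.sum_range_succ' (fun s => LinearMap.lTensor _ (lapF n) _)]
  simp only [map_smul, radial, LinearMap.rTensor_tmul, LinearMap.lTensor_tmul, Nat.sub_self,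
    pow_zero, one_mul, hB, hF, TensorProduct.zero_tmul, TensorProduct.tmul_zero, smul_zero,
    add_zero]
  rw [← Finset.sum_add_distrib]
  refine Finset.sum_eq_zero fun s hs => ?_
  have hs' : s < k := Finset.mem_range.1 hs
  rw [lapF_radial hw, show k - s = (k - (s + 1)) + 1 by omega, lapB_radial hh,
    ← TensorProduct.smul_tmul', TensorProduct.tmul_smul, smul_smul, smul_smul, ← add_smul]
  have h1 : ((fCoeff m n k p q s : ℝ) : ℂ) * ((k - s) * ((m : ℂ) / 2 + p + k - s - 1))
      = ((fCoeff m n k p q (s + 1) : ℝ) : ℂ) * ((s + 1) * (n - q - s)) := by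
    have h3 := congrArg Complex.ofReal (fCoeff_succ (p := p) hm hs' hk)
    push_cast at h3
    exact h3
  have h2 : ((k - (s + 1) : ℕ) : ℂ) = k - s - 1 := by
    rw [Nat.cast_sub (by omega)]
    push_cast
    ring
  rw [h2]
  convert zero_smul ℂ _ using 2
  linear_combination 4 * h1

/-- The pieces of the super Fischer decomposition. -/
def fischerElt (j i p q : ℕ) (h : MvPolynomial (Fin m) ℂ) (w : Grassmann n) : SuperPoly m n :=
  R2 m n ^ j * fPoly m n i p q * (h ⊗ₜ w)

theorem R2_mul_fischerElt (j i : ℕ) :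
    R2 m n * fischerElt j i p q h w = fischerElt (j + 1) i p q h w := by
  rw [fischerElt, fischerElt, pow_succ', mul_assoc, mul_assoc, mul_assoc]

theorem fischerElt_eq_pow (j i : ℕ) :
    fischerElt j i p q h w
      = (LinearMap.mulLeft ℂ (R2 m n) ^ j) (fPoly m n i p q * (h ⊗ₜ w)) := by
  rw [mulLeft_R2_pow, fischerElt, mul_assoc]

theorem weightP_fischerElt (hh : h ∈ harmonicB m p) (hw : w ∈ harmonicF n q) (j i : ℕ) :
    weightP m n (fischerElt j i p q h w)
      = ((p : ℂ) + q + (m : ℂ) / 2 - n + 2 * i + 2 * j) • fischerElt j i p q h w := by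
  rw [fischerElt_eq_pow, slTriple_superPoly.weight_raise_pow_of_eigen j (weightP_fPoly_mul hh hw i)]

theorem lapP_fischerElt_zero (hm : 0 < m) (hh : h ∈ harmonicB m p) (hw : w ∈ harmonicF n q)
    {i : ℕ} (hi : i + q ≤ n) : lapP m n (fischerElt 0 i p q h w) = 0 := by
  rw [fischerElt, pow_zero, one_mul, lapP_fPoly_mul hm hh hw hi]

theorem lapP_fischerElt_succ (hm : 0 < m) (hh : h ∈ harmonicB m p) (hw : w ∈ harmonicF n q)
    (j : ℕ) {i : ℕ} (hi : i + q ≤ n) :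
    lapP m n (fischerElt (j + 1) i p q h w)
      = (4 * (j + 1) * ((p : ℂ) + q + (m : ℂ) / 2 - n + 2 * i + j)) • fischerElt j i p q h w := by
  rw [fischerElt_eq_pow, fischerElt_eq_pow,
    slTriple_superPoly.lower_raise_pow_of_ker j (weightP_fPoly_mul hh hw i)
      (lapP_fPoly_mul hm hh hw hi)]

theorem R2_mul_lapP_fischerElt (hm : 0 < m) (hh : h ∈ harmonicB m p) (hw : w ∈ harmonicF n q)
    (j : ℕ) {i : ℕ} (hi : i + q ≤ n) :
    R2 m n * lapP m n (fischerElt j i p q h w)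
      = (4 * j * ((p : ℂ) + q + (m : ℂ) / 2 - n + 2 * i + j - 1)) • fischerElt j i p q h w := by
  rw [fischerElt_eq_pow]
  exact slTriple_superPoly.raise_lower_pow_of_ker j (weightP_fPoly_mul hh hw i)
    (lapP_fPoly_mul hm hh hw hi)

/-! ### The super Fischer decomposition -/

/-- Induction on `a + b`. By the induction hypothesis the span contains every multiple of `R²` of
the next degree, and modulo these all `r^{2a} θ^{2b} h w` with the same `a + b` agree up to sign.
One further relation then puts them all into the span. -/
theorem radial_mem_span_fischerElt (hM : 2 * n < m) (hw : w ∈ harmonicF n q) (hq : q ≤ n)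
    (p : ℕ) (a b : ℕ) :
    radial h w a b ∈ Submodule.span ℂ {u | ∃ j i, i + q ≤ n ∧ u = fischerElt j i p q h w} := by
  set D := Submodule.span ℂ {u | ∃ j i, i + q ≤ n ∧ u = fischerElt j i p q h w} with hD
  have hR : ∀ u ∈ D, R2 m n * u ∈ D := by
    intro u hu
    induction hu using Submodule.span_induction with
    | mem u hu =>
      obtain ⟨j, i, hi, rfl⟩ := hu
      rw [R2_mul_fischerElt]
      exact Submodule.subset_span ⟨j + 1, i, hi, rfl⟩
    | zero => rw [mul_zero]; exact zero_mem _
    | add u v _ _ hu hv => rw [mul_add]; exact add_mem hu hv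
    | smul c u _ hu => rw [mul_smul_comm]; exact Submodule.smul_mem _ _ hu
  have key : ∀ d a b, a + b = d → radial h w a b ∈ D := by
    intro d
    induction d with
    | zero =>
      intro a b hab
      obtain rfl : a = 0 := by omega
      obtain rfl : b = 0 := by omega
      have h0 : ((fCoeff m n 0 p q 0 : ℝ) : ℂ) ≠ 0 := by
        have := sum_neg_one_pow_mul_fCoeff_ne_zero (k := 0) (p := p) hM (by omega : 0 + q ≤ n)
        simpa using this
      have h1 : fischerElt 0 0 p q h w ∈ D := Submodule.subset_span ⟨0, 0, by omega, rfl⟩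
      rw [fischerElt, pow_zero, one_mul, fPoly_mul_tmul, Finset.sum_range_one] at h1
      exact (Submodule.smul_mem_iff _ h0).1 h1
    | succ d ih =>
      -- Modulo `R²`, `θ²` equals `-r²`, whence the sign `(-1) ^ s`.
      have hswap : ∀ s ≤ d + 1,
          radial h w (d + 1 - s) s - (-1 : ℂ) ^ s • radial h w (d + 1) 0 ∈ D := by
        intro s
        induction s with
        | zero => intro _; simp
        | succ s ihs =>
          intro hs
          have h1 := hR _ (ih (d - s) s (by omega))
          rw [R2_mul_radial, show d - s + 1 = d + 1 - s by omega] at h1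
          have h2 := sub_mem h1 (ihs (by omega))
          rw [show d + 1 - (s + 1) = d - s by omega, pow_succ]
          convert h2 using 1
          module
      -- The further relation: while `f_{d+1,p,q}` exists, it reduces modulo `R²` to a nonzero
      -- multiple of `r^{2(d+1)}`.
      have htop : radial h w (d + 1) 0 ∈ D := by
        by_cases hd : d + 1 + q ≤ n
        · have h1 : fischerElt 0 (d + 1) p q h w ∈ D := Submodule.subset_span ⟨0, d + 1, hd, rfl⟩
          rw [fischerElt, pow_zero, one_mul, fPoly_mul_tmul] at h1
          have h2 : ∑ s ∈ Finset.range (d + 1 + 1), ((fCoeff m n (d + 1) p q s : ℝ) : ℂ)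
              • (radial h w (d + 1 - s) s - (-1 : ℂ) ^ s • radial h w (d + 1) 0) ∈ D :=
            sum_mem fun s hs => Submodule.smul_mem _ _
              (hswap s (Nat.lt_succ_iff.1 (Finset.mem_range.1 hs)))
          have h3 := sub_mem h1 h2
          rw [← Finset.sum_sub_distrib] at h3
          simp only [smul_sub, sub_sub_cancel, smul_smul] at h3
          rw [← Finset.sum_smul] at h3
          refine (Submodule.smul_mem_iff _ ?_).1 h3
          have := sum_neg_one_pow_mul_fCoeff_ne_zero (p := p) hM hd
          rw [← Complex.ofReal_ne_zero] at this
          push_cast at this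
          simpa only [mul_comm] using this
        -- Beyond that range `θ^{2(d+1)} w = 0`, so `r^{2(d+1)} h w` is itself congruent to zero.
        · have h1 := hswap (d + 1) le_rfl
          have h2 : radial h w (d + 1 - (d + 1)) (d + 1) = 0 := by
            rw [radial, theta2_pow_mul_harmonic (by omega) hw, TensorProduct.tmul_zero]
          rw [h2, zero_sub, ← neg_smul] at h1
          exact (Submodule.smul_mem_iff _ (neg_ne_zero.2 (pow_ne_zero _ (by norm_num)))).1 h1
      intro a b hab
      have h1 := hswap b (by omega)
      rw [show d + 1 - b = a by omega] at h1
      simpa using add_mem h1 (Submodule.smul_mem _ ((-1 : ℂ) ^ b) htop)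
  exact key _ a b rfl

theorem span_fischerElt (hM : 2 * n < m) :
    Submodule.span ℂ {u : SuperPoly m n | ∃ j i p q, i + q ≤ n ∧ ∃ h ∈ harmonicB m p,
      ∃ w ∈ harmonicF n q, u = fischerElt j i p q h w} = ⊤ := by
  set D := Submodule.span ℂ {u : SuperPoly m n | ∃ j i p q, i + q ≤ n ∧ ∃ h ∈ harmonicB m p,
      ∃ w ∈ harmonicF n q, u = fischerElt j i p q h w}
  have h1 : ∀ P : MvPolynomial (Fin m) ℂ, ∀ a : Grassmann n, P ⊗ₜ a ∈ D := by
    intro P a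
    have hP : P ∈ Submodule.span ℂ {u : MvPolynomial (Fin m) ℂ | ∃ j p, ∃ h ∈ harmonicB m p,
      u = normSqB m ^ j * h} := span_normSqB_pow_mul_harmonic (m := m) (by omega) ▸ trivial
    induction hP using Submodule.span_induction with
    | mem P hP =>
      obtain ⟨k, p, h, hh, rfl⟩ := hP
      have ha : a ∈ Submodule.span ℂ {u : Grassmann n | ∃ j q, j + q ≤ n ∧ ∃ w ∈ harmonicF n q,
        u = theta2 n ^ j * w} := span_theta2_pow_mul_harmonic ▸ trivial
      induction ha using Submodule.span_induction with
      | mem a ha =>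
        obtain ⟨b, q, hbq, w, hw, rfl⟩ := ha
        refine Submodule.span_mono ?_
          (radial_mem_span_fischerElt (h := h) hM hw (by omega : q ≤ n) p k b)
        rintro _ ⟨j, i, hi, rfl⟩
        exact ⟨j, i, p, q, hi, h, hh, w, hw, rfl⟩
      | zero => rw [TensorProduct.tmul_zero]; exact zero_mem _
      | add a b _ _ ha hb => rw [TensorProduct.tmul_add]; exact add_mem ha hb
      | smul c a _ ha => rw [TensorProduct.tmul_smul]; exact Submodule.smul_mem _ _ ha
    | zero => rw [TensorProduct.zero_tmul]; exact zero_mem _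
    | add P Q _ _ hP hQ => rw [TensorProduct.add_tmul]; exact add_mem hP hQ
    | smul c P _ hP => rw [← TensorProduct.smul_tmul']; exact Submodule.smul_mem _ _ hP
  refine eq_top_iff.2 fun P _ => ?_
  induction P using TensorProduct.induction_on with
  | zero => exact zero_mem _
  | tmul P a => exact h1 P a
  | add P Q hP hQ => exact add_mem (hP trivial) (hQ trivial)

end SuperPolynomials

section SuperPolynomials

variable {m n : ℕ}

/-! ### The joint spectrum of the commuting operators -/

/-- The indices `(j, i, p, q)` of the super Fischer decomposition. -/
abbrev FischerIndex (n : ℕ) : Type := {t : ℕ × ℕ × ℕ × ℕ // t.2.1 + t.2.2.2 ≤ n}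

/-- The piece `R^{2j} f_{i,p,q} H^b_p H^f_q`. -/
def fischerPiece (m n : ℕ) (t : FischerIndex n) : Submodule ℂ (SuperPoly m n) :=
  Submodule.span ℂ {u | ∃ h ∈ harmonicB m t.1.2.2.1, ∃ w ∈ harmonicF n t.1.2.2.2,
    u = fischerElt t.1.1 t.1.2.1 t.1.2.2.1 t.1.2.2.2 h w}

/-- Commuting operators that separate the pieces of the super Fischer decomposition. -/
def fischerOp (m n : ℕ) : Fin 4 → Module.End ℂ (SuperPoly m n) :=
  ![weightP m n,
    LinearMap.mulLeft ℂ (R2 m n) * lapP m n,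
    LinearMap.rTensor (Grassmann n)
      (LinearMap.mulLeft ℂ (normSqB m) * lapB m - weightB m * weightB m + (2 : ℂ) • weightB m),
    LinearMap.lTensor (MvPolynomial (Fin m) ℂ)
      (LinearMap.mulLeft ℂ (theta2 n) * lapF n
        - (eulerF n - (n : ℂ) • 1) * (eulerF n - (n : ℂ) • 1)
        + (2 : ℂ) • (eulerF n - (n : ℂ) • 1))]

/-- The eigenvalues of `fischerOp` on the pieces. -/
def fischerEigenvalue (m n : ℕ) (t : FischerIndex n) : Fin 4 → ℂ :=
  ![(t.1.2.2.1 : ℂ) + t.1.2.2.2 + (m : ℂ) / 2 - n + 2 * t.1.2.1 + 2 * t.1.1,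
    4 * t.1.1 * ((t.1.2.2.1 : ℂ) + t.1.2.2.2 + (m : ℂ) / 2 - n + 2 * t.1.2.1 + t.1.1 - 1),
    -(((t.1.2.2.1 : ℂ) + (m : ℂ) / 2) * ((t.1.2.2.1 : ℂ) + (m : ℂ) / 2 - 2)),
    -(((t.1.2.2.2 : ℂ) + -(n : ℂ)) * ((t.1.2.2.2 : ℂ) + -(n : ℂ) - 2))]

/-- The fermionic Casimir determines `q` and the bosonic one `p`, the latter with the help of the
degree; the degree then gives `i + j`, and `R²∇²` separates the values of `j`. -/
theorem fischerEigenvalue_injective (hM : 2 * n < m) :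
    Function.Injective (fischerEigenvalue m n) := by
  rintro ⟨⟨j, i, p, q⟩, ht⟩ ⟨⟨j', i', p', q'⟩, ht'⟩ he
  simp only at ht ht'
  have h0 := congrFun he 0
  have h1 := congrFun he 1
  have h2 := congrFun he 2
  have h3 := congrFun he 3
  simp only [fischerEigenvalue, Matrix.cons_val] at h0 h1 h2 h3
  have e0 : ((p + q + 2 * i + 2 * j : ℤ) : ℂ) = (p' + q' + 2 * i' + 2 * j' : ℤ) := by
    push_cast
    linear_combination h0
  have e1 : ((j * (2 * p + 2 * q + m - 2 * n + 4 * i + 2 * j - 2) : ℤ) : ℂ)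
      = (j' * (2 * p' + 2 * q' + m - 2 * n + 4 * i' + 2 * j' - 2) : ℤ) := by
    push_cast
    linear_combination h1 / 2
  have e2 : (((p - p') * (p + p' + m - 2) : ℤ) : ℂ) = (0 : ℤ) := by
    push_cast
    linear_combination -h2
  have e3 : (((q - q') * (q + q' - 2 * n - 2) : ℤ) : ℂ) = (0 : ℤ) := by
    push_cast
    linear_combination -h3
  rw [Int.cast_inj] at e0 e1 e2 e3
  obtain rfl : q = q' := by
    rcases mul_eq_zero.1 e3 with h | h <;> omega
  obtain rfl : p = p' := by
    -- The Casimir alone cannot tell `p = 0` from `p = 1` when `m = 1`. Then `n = 0` and `q = 0`,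
    -- and `e0` shows that `p` and `p'` have the same parity.
    rcases mul_eq_zero.1 e2 with h | h <;> omega
  have e4 : ((j : ℤ) - j') * (2 * i + 2 * i' + 2 * p + 2 * q + m - 2 * n - 2) = 0 := by
    have hi : (i : ℤ) + j = i' + j' := by omega
    have hi' : (i' : ℤ) = i + j - j' := by omega
    rw [hi'] at e1 ⊢
    linear_combination e1
  obtain rfl : j = j' := by
    -- If `j ≠ j'` then `i ≠ i'`, so `2i + 2i' ≥ 2` and the other factor is at least `M > 0`.
    rcases mul_eq_zero.1 e4 with h | h <;> omega
  obtain rfl : i = i' := by omega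
  rfl

/-- Each Casimir acts on all `r^{2a} θ^{2b} h w` by a scalar independent of `a` and `b`, so its
eigenvalue on a piece can be read off from these. -/
theorem fischerElt_mem_span_radial (j i p q : ℕ) (h : MvPolynomial (Fin m) ℂ) (w : Grassmann n) :
    fischerElt j i p q h w ∈ Submodule.span ℂ {u | ∃ a b, u = radial h w a b} := by
  induction j with
  | zero =>
    rw [fischerElt, pow_zero, one_mul, fPoly_mul_tmul]
    exact sum_mem fun s _ => Submodule.smul_mem _ _ (Submodule.subset_span ⟨_, _, rfl⟩)
  | succ j ih =>
    rw [← R2_mul_fischerElt]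
    generalize fischerElt j i p q h w = v at ih
    induction ih using Submodule.span_induction with
    | mem u hu =>
      obtain ⟨a, b, rfl⟩ := hu
      rw [R2_mul_radial]
      exact add_mem (Submodule.subset_span ⟨_, _, rfl⟩) (Submodule.subset_span ⟨_, _, rfl⟩)
    | zero => rw [mul_zero]; exact zero_mem _
    | add u v _ _ hu hv => rw [mul_add]; exact add_mem hu hv
    | smul c u _ hu => rw [mul_smul_comm]; exact Submodule.smul_mem _ _ hu

theorem eigen_of_mem_span {V : Type*} [AddCommGroup V] [Module ℂ V] {A : Module.End ℂ V} {c : ℂ}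
    {s : Set V} (hs : ∀ u ∈ s, A u = c • u) {u : V} (hu : u ∈ Submodule.span ℂ s) :
    A u = c • u := by
  have h : Submodule.span ℂ s ≤ LinearMap.ker (A - c • 1) :=
    Submodule.span_le.2 fun v hv => by simp [hs v hv]
  simpa [sub_eq_zero] using h hu

theorem fischerOp_apply (hm : 0 < m) (t : FischerIndex n) {u : SuperPoly m n}
    (hu : u ∈ fischerPiece m n t) (l : Fin 4) :
    fischerOp m n l u = fischerEigenvalue m n t l • u := by
  obtain ⟨⟨j, i, p, q⟩, ht⟩ := t
  refine eigen_of_mem_span ?_ hu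
  rintro _ ⟨h, hh, w, hw, rfl⟩
  simp only at ht hh hw ⊢
  fin_cases l
  · exact weightP_fischerElt hh hw j i
  · exact R2_mul_lapP_fischerElt hm hh hw j ht
  · refine eigen_of_mem_span ?_ (fischerElt_mem_span_radial j i p q h w)
    rintro _ ⟨a, b, rfl⟩
    have := (slTriple_poly m).casimir_pow_of_ker a (weightB_of_isHomogeneous hh.1) hh.2
    rw [LinearMap.pow_mulLeft, LinearMap.mulLeft_apply] at this
    refine (congrArg (fun z => z ⊗ₜ[ℂ] (theta2 n ^ b * w)) this).trans ?_
    rw [← TensorProduct.smul_tmul']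
    rfl
  · refine eigen_of_mem_span ?_ (fischerElt_mem_span_radial j i p q h w)
    rintro _ ⟨a, b, rfl⟩
    have := slTriple_grassmann.casimir_pow_of_ker b (weightF_of_mem hw.1) hw.2
    rw [LinearMap.pow_mulLeft, LinearMap.mulLeft_apply] at this
    refine (congrArg (fun z => (normSqB m ^ a * h) ⊗ₜ[ℂ] z) this).trans ?_
    rw [TensorProduct.tmul_smul]
    rfl

theorem iSup_fischerPiece (hM : 2 * n < m) : ⨆ t, fischerPiece m n t = ⊤ := by
  rw [← top_le_iff, ← span_fischerElt hM]
  refine Submodule.span_le.2 ?_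
  rintro _ ⟨j, i, p, q, hi, h, hh, w, hw, rfl⟩
  exact Submodule.mem_iSup_of_mem ⟨(j, i, p, q), hi⟩
    (Submodule.subset_span ⟨h, hh, w, hw, rfl⟩)

/-! ### The twist on superpolynomials -/

theorem map_twistHom_fischerElt (j i p q : ℕ) (h : MvPolynomial (Fin m) ℂ) (w : Grassmann n) :
    Algebra.TensorProduct.map (AlgHom.id ℂ (MvPolynomial (Fin m) ℂ)) (twistHom n)
      (fischerElt j i p q h w) = fischerElt j i p q h (twistHom n w) := by
  have h1 : Algebra.TensorProduct.map (AlgHom.id ℂ (MvPolynomial (Fin m) ℂ)) (twistHom n)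
      (r2 m n) = r2 m n := by
    rw [r2, Algebra.TensorProduct.map_tmul, map_one]
    rfl
  have h2 : Algebra.TensorProduct.map (AlgHom.id ℂ (MvPolynomial (Fin m) ℂ)) (twistHom n)
      (th2 m n) = th2 m n := by
    rw [th2, Algebra.TensorProduct.map_tmul, map_one, twistHom_theta2]
  simp only [fischerElt, map_mul, map_pow, R2, map_add, h1, h2, fPoly, map_sum, map_smul,
    Algebra.TensorProduct.map_tmul, AlgHom.id_apply]

theorem tilde_mem_harmonicF {q : ℕ} {w : Grassmann n} (hw : w ∈ harmonicF n q) :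
    tilde n w ∈ harmonicF n q := by
  rw [tilde_of_mem hw.1]
  exact Submodule.smul_mem _ _ (twistHom_mem_harmonicF hw)

theorem fischerElt_smul_right (j i p q : ℕ) (h : MvPolynomial (Fin m) ℂ) (c : ℂ)
    (w : Grassmann n) : fischerElt j i p q h (c • w) = c • fischerElt j i p q h w := by
  rw [fischerElt, TensorProduct.tmul_smul, mul_smul_comm, fischerElt]

/-- The homomorphism `id ⊗ twistHom` fixes `r²` and `θ²`, so it maps each piece to itself and acts
only on the fermionic harmonic. Composing it with the operator that is the scalar `(-1) ^ i *
reverseSign q` on each piece gives the twist. -/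
theorem exists_polyTwist (hM : 2 * n < m) :
    ∃ T : Module.End ℂ (SuperPoly m n), ∀ j i p q, i + q ≤ n → ∀ h ∈ harmonicB m p,
      ∀ w ∈ harmonicF n q,
        T (fischerElt j i p q h w) = (-1 : ℂ) ^ i • fischerElt j i p q h (tilde n w) := by
  obtain ⟨S, hS⟩ := exists_scalar_operator (fischerOp m n) (fischerEigenvalue m n)
    (fischerEigenvalue_injective hM) (fischerPiece m n) (iSup_fischerPiece hM)
    (fun t u hu => fischerOp_apply (by omega) t hu)
    (fun t => (-1 : ℂ) ^ t.1.2.1 * reverseSign t.1.2.2.2)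
  refine ⟨S ∘ₗ (Algebra.TensorProduct.map (AlgHom.id ℂ (MvPolynomial (Fin m) ℂ))
    (twistHom n)).toLinearMap, fun j i p q hi h hh w hw => ?_⟩
  rw [LinearMap.comp_apply, AlgHom.toLinearMap_apply, map_twistHom_fischerElt,
    hS ⟨(j, i, p, q), hi⟩ _
      (Submodule.subset_span ⟨h, hh, twistHom n w, twistHom_mem_harmonicF hw, rfl⟩),
    tilde_of_mem hw.1, fischerElt_smul_right, smul_smul]

theorem linearMap_ext_fischerElt (hM : 2 * n < m) {V : Type*} [AddCommGroup V] [Module ℂ V]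
    {A B : SuperPoly m n →ₗ[ℂ] V}
    (hAB : ∀ j i p q, i + q ≤ n → ∀ h ∈ harmonicB m p, ∀ w ∈ harmonicF n q,
      A (fischerElt j i p q h w) = B (fischerElt j i p q h w)) : A = B := by
  refine LinearMap.ext_on (span_fischerElt hM) ?_
  rintro _ ⟨j, i, p, q, hi, h, hh, w, hw, rfl⟩
  exact hAB j i p q hi h hh w hw

/-! ### Commutation of the twist with `R²`, `∇²` and the weight operator. -/

section Twist

variable {T : Module.End ℂ (SuperPoly m n)}

theorem polyTwist_R2_mul (hM : 2 * n < m) (hT : ∀ j i p q, i + q ≤ n → ∀ h ∈ harmonicB m p,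
      ∀ w ∈ harmonicF n q,
        T (fischerElt j i p q h w) = (-1 : ℂ) ^ i • fischerElt j i p q h (tilde n w))
    (P : SuperPoly m n) : T (R2 m n * P) = R2 m n * T P := by
  have h : T * LinearMap.mulLeft ℂ (R2 m n) = LinearMap.mulLeft ℂ (R2 m n) * T := by
    refine linearMap_ext_fischerElt hM fun j i p q hi h hh w hw => ?_
    rw [Module.End.mul_apply, Module.End.mul_apply, LinearMap.mulLeft_apply, R2_mul_fischerElt,
      hT _ _ _ _ hi _ hh _ hw, hT _ _ _ _ hi _ hh _ hw, map_smul, LinearMap.mulLeft_apply,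
      R2_mul_fischerElt]
  exact congr($h P)

theorem polyTwist_lapP (hM : 2 * n < m) (hT : ∀ j i p q, i + q ≤ n → ∀ h ∈ harmonicB m p,
      ∀ w ∈ harmonicF n q,
        T (fischerElt j i p q h w) = (-1 : ℂ) ^ i • fischerElt j i p q h (tilde n w))
    (P : SuperPoly m n) : T (lapP m n P) = lapP m n (T P) := by
  have h : T * lapP m n = lapP m n * T := by
    refine linearMap_ext_fischerElt hM fun j i p q hi h hh w hw => ?_
    have hm : 0 < m := by omega
    rw [Module.End.mul_apply, Module.End.mul_apply, hT _ _ _ _ hi _ hh _ hw, map_smul]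
    cases j with
    | zero =>
      rw [lapP_fischerElt_zero hm hh hw hi, lapP_fischerElt_zero hm hh (tilde_mem_harmonicF hw) hi,
        map_zero, smul_zero]
    | succ j =>
      rw [lapP_fischerElt_succ hm hh hw j hi,
        lapP_fischerElt_succ hm hh (tilde_mem_harmonicF hw) j hi, map_smul,
        hT _ _ _ _ hi _ hh _ hw, smul_comm]
  exact congr($h P)

theorem polyTwist_weightP (hM : 2 * n < m) (hT : ∀ j i p q, i + q ≤ n → ∀ h ∈ harmonicB m p,
      ∀ w ∈ harmonicF n q,
        T (fischerElt j i p q h w) = (-1 : ℂ) ^ i • fischerElt j i p q h (tilde n w))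
    (P : SuperPoly m n) : T (weightP m n P) = weightP m n (T P) := by
  have h : T * weightP m n = weightP m n * T := by
    refine linearMap_ext_fischerElt hM fun j i p q hi h hh w hw => ?_
    rw [Module.End.mul_apply, Module.End.mul_apply, hT _ _ _ _ hi _ hh _ hw, map_smul,
      weightP_fischerElt hh hw, weightP_fischerElt hh (tilde_mem_harmonicF hw), map_smul,
      hT _ _ _ _ hi _ hh _ hw, smul_comm]
  exact congr($h P)

end Twist

end SuperPolynomials

section Gauss

variable {m n : ℕ}

/-! ### The space `𝒫 exp(-R²/2)` -/

theorem mulGauss_tmul (p : MvPolynomial (Fin m) ℂ) (a : Grassmann n) :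
    mulGauss m n (p ⊗ₜ a)
      = (MvPolynomial.aeval coord p * gaussB m) ⊗ₜ (a * gaussF n) := by
  rw [mulGauss, LinearMap.comp_apply, AlgHom.toLinearMap_apply, polyFun,
    Algebra.TensorProduct.map_tmul, LinearMap.mulRight_apply, Algebra.TensorProduct.tmul_mul_tmul]
  rfl

theorem polyFun_injective : Function.Injective (polyFun m n) := by
  have h := Module.Flat.rTensor_preserves_injective_linearMap (M := Grassmann n)
    (MvPolynomial.aeval (R := ℂ) (coord (m := m))).toLinearMap aeval_coord_injective
  exact h

/-- Both Gaussians are units. Injectivity lets operators on `𝒫 exp(-R²/2)` be studied on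
polynomials. -/
theorem mulGauss_injective : Function.Injective (mulGauss m n) := by
  have hu : IsUnit (gaussB m ⊗ₜ gaussF n : SuperFun m n) := by
    have h1 : IsUnit (gaussB m ⊗ₜ 1 : SuperFun m n) :=
      isUnit_gaussB.map (Algebra.TensorProduct.includeLeft : smooth m →ₐ[ℂ] SuperFun m n)
    have h2 : IsUnit (1 ⊗ₜ gaussF n : SuperFun m n) :=
      isUnit_gaussF.map (Algebra.TensorProduct.includeRight : Grassmann n →ₐ[ℂ] SuperFun m n)
    have h3 := h1.mul h2
    rwa [Algebra.TensorProduct.tmul_mul_tmul, mul_one, one_mul] at h3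
  intro P Q h
  exact polyFun_injective (hu.mul_left_injective h)

theorem mulR2_mulGauss (P : SuperPoly m n) :
    mulR2 m n (mulGauss m n P) = mulGauss m n (R2 m n * P) := by
  rw [mulR2, mulGauss, LinearMap.comp_apply, LinearMap.comp_apply, LinearMap.mulLeft_apply,
    LinearMap.mulRight_apply, LinearMap.mulRight_apply, AlgHom.toLinearMap_apply,
    AlgHom.toLinearMap_apply, map_mul, mul_assoc]

/-- Shows that `∇²` preserves `𝒫 exp(-R²/2)` and reduces its commutation with `T` to that of three
operators on polynomials. -/
theorem lap_mulGauss (P : SuperPoly m n) :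
    lap m n (mulGauss m n P)
      = mulGauss m n (lapP m n P - (2 : ℂ) • weightP m n P + R2 m n * P) := by
  induction P using TensorProduct.induction_on with
  | zero => simp only [map_zero, smul_zero, mul_zero, sub_zero, add_zero]
  | tmul p a =>
    rw [mulGauss_tmul, lap, LinearMap.add_apply, LinearMap.rTensor_tmul, LinearMap.lTensor_tmul,
      lapB_aeval_mul_gaussB, lapF_mul_gaussF, ← mulGauss_tmul, ← mulGauss_tmul, ← map_add,
      R2_mul_tmul, lapP, weightP, LinearMap.add_apply, LinearMap.add_apply, LinearMap.rTensor_tmul,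
      LinearMap.lTensor_tmul, LinearMap.rTensor_tmul, LinearMap.lTensor_tmul]
    congr 1
    simp only [TensorProduct.add_tmul, TensorProduct.sub_tmul, TensorProduct.tmul_add,
      TensorProduct.tmul_sub, ← TensorProduct.smul_tmul', TensorProduct.tmul_smul]
    module
  | add P Q hP hQ =>
    rw [map_add, map_add, hP, hQ, ← map_add]
    congr 1
    rw [map_add, map_add, mul_add, smul_add]
    abel

theorem mulR2_mem {f : SuperFun m n} (hf : f ∈ polyGauss m n) : mulR2 m n f ∈ polyGauss m n := by
  obtain ⟨P, rfl⟩ := hf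
  exact ⟨_, (mulR2_mulGauss P).symm⟩

theorem lap_mem {f : SuperFun m n} (hf : f ∈ polyGauss m n) : lap m n f ∈ polyGauss m n := by
  obtain ⟨P, rfl⟩ := hf
  exact ⟨_, (lap_mulGauss P).symm⟩

/-! ### Multiplication by `R²` and the commutator `[∇², R²]` -/

theorem mulR2_tmul (f : smooth m) (a : Grassmann n) :
    mulR2 m n (f ⊗ₜ a) = ((∑ i, coord i ^ 2) * f) ⊗ₜ a + f ⊗ₜ (theta2 n * a) := by
  have h : polyFun m n (R2 m n) = (∑ i, coord i ^ 2) ⊗ₜ 1 + 1 ⊗ₜ theta2 n := by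
    rw [R2, map_add, r2, th2, polyFun, Algebra.TensorProduct.map_tmul,
      Algebra.TensorProduct.map_tmul, map_one, map_one, map_sum]
    simp only [map_pow, MvPolynomial.aeval_X]
    rfl
  rw [mulR2, LinearMap.mulLeft_apply, h, add_mul, Algebra.TensorProduct.tmul_mul_tmul,
    Algebra.TensorProduct.tmul_mul_tmul, one_mul, one_mul]

theorem mulR2_mul (f g : SuperFun m n) : mulR2 m n f * g = f * mulR2 m n g := by
  induction f using TensorProduct.induction_on with
  | zero => rw [map_zero, zero_mul, zero_mul]
  | add f f' hf hf' => rw [map_add, add_mul, hf, hf', add_mul]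
  | tmul f a =>
    induction g using TensorProduct.induction_on with
    | zero => rw [map_zero, mul_zero, mul_zero]
    | add g g' hg hg' => rw [map_add, mul_add, hg, hg', mul_add]
    | tmul g b =>
      rw [mulR2_tmul, mulR2_tmul, add_mul, mul_add]
      simp only [Algebra.TensorProduct.tmul_mul_tmul]
      have e1 : (∑ i, coord i ^ 2) * f * g = f * ((∑ i, coord i ^ 2) * g) := by ring
      have e2 : theta2 n * a * b = a * (theta2 n * b) := by
        rw [(commute_theta2 a).eq, mul_assoc]
      rw [e1, e2]

theorem slTriple_superFun :
    SlTriple (mulR2 m n) (lap m n)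
      (LinearMap.rTensor (Grassmann n)
        ((∑ i : Fin m, LinearMap.mulLeft ℂ (coord i) * bDeriv i) + ((m : ℂ) / 2) • 1)
        + LinearMap.lTensor (smooth m) (eulerF n - (n : ℂ) • 1)) := by
  have e : mulR2 m n
      = LinearMap.rTensor (Grassmann n) (LinearMap.mulLeft ℂ (∑ i : Fin m, coord i ^ 2))
        + LinearMap.lTensor (smooth m) (LinearMap.mulLeft ℂ (theta2 n)) := by
    refine TensorProduct.ext' fun f a => ?_
    rw [mulR2_tmul]
    rfl
  rw [e]
  exact slTriple_smooth.tensor slTriple_grassmann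

/-- As `[∇², R²] = 4(𝔼 + M/2)`, the adjoint of `2𝔼 + M` follows from those of `∇²` and `R²` without
further integration. -/
theorem eulerShift_eq_commutator :
    eulerShift m n = (1 / 2 : ℂ) • (lap m n * mulR2 m n + (-1 : ℂ) • (mulR2 m n * lap m n)) := by
  refine TensorProduct.ext' fun f a => ?_
  have h := slTriple_superFun.lower_raise (f ⊗ₜ[ℂ] a)
  simp only [LinearMap.add_apply, LinearMap.smul_apply, Module.End.mul_apply, h]
  simp only [eulerShift, euler, superDim, LinearMap.add_apply, LinearMap.sub_apply,
    LinearMap.smul_apply, Module.End.one_apply, LinearMap.rTensor_tmul, LinearMap.lTensor_tmul,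
    TensorProduct.add_tmul, TensorProduct.tmul_sub, ← TensorProduct.smul_tmul',
    TensorProduct.tmul_smul]
  push_cast
  module

/-! ### Complex conjugation of superfunctions -/

theorem superConj_tmul (f : smooth m) (a : Grassmann n) :
    superConj m n (f ⊗ₜ a) = bConj m f ⊗ₜ gConj n a := rfl

theorem superConj_mem {f : SuperFun m n} (hf : f ∈ polyGauss m n) :
    superConj m n f ∈ polyGauss m n := by
  obtain ⟨P, rfl⟩ := hf
  induction P using TensorProduct.induction_on with
  | zero => rw [map_zero, map_zero]; exact zero_mem _
  | add P Q hP hQ => rw [map_add, map_add]; exact add_mem hP hQ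
  | tmul p a =>
    refine ⟨MvPolynomial.map (starRingEnd ℂ) p ⊗ₜ gConj n a, ?_⟩
    rw [mulGauss_tmul, mulGauss_tmul, superConj_tmul, bConj_mul, gConj_mul, bConj_aeval,
      bConj_gaussB, gConj_gaussF]

theorem superConj_lap (f : SuperFun m n) :
    superConj m n (lap m n f) = lap m n (superConj m n f) := by
  induction f using TensorProduct.induction_on with
  | zero => simp only [map_zero]
  | add f g hf hg => simp only [map_add, hf, hg]
  | tmul f a =>
    rw [superConj_tmul, lap, LinearMap.add_apply, LinearMap.add_apply, map_add,
      LinearMap.rTensor_tmul, LinearMap.lTensor_tmul, LinearMap.rTensor_tmul,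
      LinearMap.lTensor_tmul, superConj_tmul, superConj_tmul, gConj_lapF]
    congr 2
    simp only [LinearMap.sum_apply, map_sum, Module.End.mul_apply, bConj_bDeriv]

theorem superConj_mulR2 (f : SuperFun m n) :
    superConj m n (mulR2 m n f) = mulR2 m n (superConj m n f) := by
  induction f using TensorProduct.induction_on with
  | zero => simp only [map_zero]
  | add f g hf hg => simp only [map_add, hf, hg]
  | tmul f a =>
    rw [superConj_tmul, mulR2_tmul, mulR2_tmul, map_add, superConj_tmul, superConj_tmul,
      gConj_mul, gConj_theta2, bConj_mul, map_sum]
    simp only [pow_two, bConj_mul, bConj_coord]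

/-! ### Integrals of polynomials times Gaussians -/

open MeasureTheory

theorem abs_le_mul_exp_sq {ε : ℝ} (hε : 0 < ε) (t : ℝ) :
    |t| ≤ (1 + 1 / ε) * Real.exp (ε * t ^ 2) := by
  have h1 : ε * t ^ 2 + 1 ≤ Real.exp (ε * t ^ 2) := Real.add_one_le_exp _
  have h2 : |t| ≤ 1 + t ^ 2 := by
    rw [← sq_abs]
    nlinarith [sq_nonneg (|t| - 1), abs_nonneg t]
  have h3 : 1 + t ^ 2 ≤ (1 + 1 / ε) * (ε * t ^ 2 + 1) := by
    have : (1 + 1 / ε) * (ε * t ^ 2 + 1) = 1 + t ^ 2 + ε * t ^ 2 + 1 / ε := by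
      field_simp
      ring
    rw [this]
    have := mul_nonneg hε.le (sq_nonneg t)
    have := (one_div_pos.2 hε).le
    linarith
  exact h2.trans (h3.trans (mul_le_mul_of_nonneg_left h1 (by positivity)))

/-- Half of `ε` is kept for each new variable, whose own growth is absorbed by the other half. -/
theorem norm_eval_le_mul_exp (p : MvPolynomial (Fin m) ℂ) {ε : ℝ} (hε : 0 < ε) :
    ∃ C, ∀ x : EuclideanSpace ℝ (Fin m),
      ‖(MvPolynomial.aeval coord p : smooth m).1 x‖ ≤ C * Real.exp (ε * ‖x‖ ^ 2) := by
  simp only [aeval_coord_apply]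
  induction p using MvPolynomial.induction_on generalizing ε with
  | C a =>
    refine ⟨‖a‖, fun x => ?_⟩
    rw [MvPolynomial.eval_C]
    exact le_mul_of_one_le_right (norm_nonneg _) (Real.one_le_exp (by positivity))
  | add p q hp hq =>
    obtain ⟨C, hC⟩ := hp hε
    obtain ⟨D, hD⟩ := hq hε
    refine ⟨C + D, fun x => ?_⟩
    rw [map_add, add_mul]
    exact (norm_add_le _ _).trans (add_le_add (hC x) (hD x))
  | mul_X p j hp =>
    obtain ⟨C, hC⟩ := hp (half_pos hε)
    refine ⟨C * (1 + 1 / (ε / 2)), fun x => ?_⟩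
    have h1 := abs_le_mul_exp_sq (half_pos hε) ‖x‖
    rw [abs_norm] at h1
    have h2 : ‖((x j : ℝ) : ℂ)‖ ≤ ‖x‖ := by
      rw [Complex.norm_real]
      exact PiLp.norm_apply_le x j
    rw [map_mul, MvPolynomial.eval_X, norm_mul]
    calc _ ≤ (C * Real.exp (ε / 2 * ‖x‖ ^ 2))
          * ((1 + 1 / (ε / 2)) * Real.exp (ε / 2 * ‖x‖ ^ 2)) :=
          mul_le_mul (hC x) (h2.trans h1) (norm_nonneg _) ((norm_nonneg _).trans (hC x))
      _ = C * (1 + 1 / (ε / 2))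
          * (Real.exp (ε / 2 * ‖x‖ ^ 2) * Real.exp (ε / 2 * ‖x‖ ^ 2)) := by ring
      _ = _ := by
        rw [← Real.exp_add]
        congr 2
        ring

theorem integrable_exp_neg_norm_sq (b : ℝ) (hb : 0 < b) :
    Integrable fun x : EuclideanSpace ℝ (Fin m) => Real.exp (-b * ‖x‖ ^ 2) := by
  have h := (GaussianFourier.integrable_cexp_neg_mul_sq_norm_add (V := EuclideanSpace ℝ (Fin m))
    (b := (b : ℂ)) (by simpa using hb) 0 0).norm
  refine h.congr (Filter.Eventually.of_forall fun x => ?_)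
  simp only [Complex.norm_exp]
  congr 1
  have : (-(b : ℂ) * (‖x‖ : ℂ) ^ 2 + 0 * ((inner ℝ 0 x : ℝ) : ℂ)) = ((-b * ‖x‖ ^ 2 : ℝ) : ℂ) := by
    push_cast
    ring
  rw [this, Complex.ofReal_re]

theorem gaussB_apply (x : EuclideanSpace ℝ (Fin m)) :
    (gaussB m).1 x = ((Real.exp (-(1 / 2) * ‖x‖ ^ 2) : ℝ) : ℂ) := by
  change ((Real.exp (-(∑ i, x i ^ 2) / 2) : ℝ) : ℂ) = _
  rw [EuclideanSpace.real_norm_sq_eq]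
  congr 2
  ring

theorem integrable_poly_mul_gauss (p : MvPolynomial (Fin m) ℂ) :
    Integrable (MvPolynomial.aeval coord p * (gaussB m * gaussB m) : smooth m).1 := by
  obtain ⟨C, hC⟩ := norm_eval_le_mul_exp p (by norm_num : (0 : ℝ) < 1 / 2)
  have hc : ContDiff ℝ ∞ (MvPolynomial.aeval coord p * (gaussB m * gaussB m) : smooth m).1 :=
    (MvPolynomial.aeval coord p * (gaussB m * gaussB m) : smooth m).2
  refine ((integrable_exp_neg_norm_sq (1 / 2) (by norm_num)).const_mul C).mono'
    hc.continuous.aestronglyMeasurable (Filter.Eventually.of_forall fun x => ?_)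
  change ‖(MvPolynomial.aeval coord p : smooth m).1 x * ((gaussB m).1 x * (gaussB m).1 x)‖ ≤ _
  rw [gaussB_apply, norm_mul, norm_mul, Complex.norm_real, Real.norm_eq_abs, Real.abs_exp,
    ← Real.exp_add]
  refine (mul_le_mul_of_nonneg_right (hC x) (Real.exp_pos _).le).trans (le_of_eq ?_)
  rw [mul_assoc, ← Real.exp_add]
  congr 2
  ring

/-- Polynomials times `exp(-r²)`. -/
def polyGaussSq (m : ℕ) : Submodule ℂ (smooth m) :=
  LinearMap.range (LinearMap.mulRight ℂ (gaussB m * gaussB m)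
    ∘ₗ (MvPolynomial.aeval (R := ℂ) (coord (m := m))).toLinearMap)

theorem integrable_of_mem_polyGaussSq {f : smooth m} (hf : f ∈ polyGaussSq m) :
    Integrable f.1 := by
  obtain ⟨p, rfl⟩ := hf
  exact integrable_poly_mul_gauss p

theorem mul_mem_polyGaussSq (p q : MvPolynomial (Fin m) ℂ) :
    (MvPolynomial.aeval coord p * gaussB m) * (MvPolynomial.aeval coord q * gaussB m)
      ∈ polyGaussSq m := by
  refine ⟨p * q, ?_⟩
  rw [LinearMap.comp_apply, AlgHom.toLinearMap_apply, map_mul, LinearMap.mulRight_apply]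
  ring

theorem integral_bDeriv_mul (i : Fin m) (p q : MvPolynomial (Fin m) ℂ) :
    ∫ x, (bDeriv i (MvPolynomial.aeval coord p * gaussB m)
        * (MvPolynomial.aeval coord q * gaussB m) : smooth m).1 x
      = -∫ x, (MvPolynomial.aeval coord p * gaussB m
        * bDeriv i (MvPolynomial.aeval coord q * gaussB m) : smooth m).1 x := by
  set u : smooth m := MvPolynomial.aeval coord p * gaussB m with hu
  set v : smooth m := MvPolynomial.aeval coord q * gaussB m with hv
  have hu' : ContDiff ℝ ∞ u.1 := u.2
  have hv' : ContDiff ℝ ∞ v.1 := v.2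
  have h1 : Integrable (bDeriv i u * v : smooth m).1 := by
    rw [hu, hv, bDeriv_aeval_mul_gaussB]
    exact integrable_of_mem_polyGaussSq (mul_mem_polyGaussSq _ _)
  have h2 : Integrable (u * bDeriv i v : smooth m).1 := by
    rw [hu, hv, bDeriv_aeval_mul_gaussB]
    exact integrable_of_mem_polyGaussSq (mul_mem_polyGaussSq _ _)
  have h3 : Integrable (u * v : smooth m).1 :=
    integrable_of_mem_polyGaussSq (mul_mem_polyGaussSq _ _)
  have h := integral_mul_fderiv_eq_neg_fderiv_mul_of_integrable (μ := volume)
    (v := EuclideanSpace.single i (1 : ℝ)) h1 h2 h3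
    (fun x _ => hu'.differentiable (by simp) x) (fun x _ => hv'.differentiable (by simp) x)
  exact (neg_eq_iff_eq_neg.2 h).symm

/-- Smooth integrable functions with vanishing integral. -/
def integralZero (m : ℕ) : Submodule ℂ (smooth m) where
  carrier := {f | Integrable f.1 ∧ ∫ x, f.1 x = 0}
  add_mem' {f g} hf hg := by
    refine ⟨hf.1.add hg.1, ?_⟩
    have h := integral_add hf.1 hg.1
    rw [hf.2, hg.2, add_zero] at h
    exact h
  zero_mem' := ⟨integrable_zero _ _ _, integral_zero _ _⟩
  smul_mem' c f hf := by
    refine ⟨hf.1.smul c, ?_⟩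
    have h := integral_smul c f.1 (μ := volume)
    rw [hf.2, smul_zero] at h
    exact h

/-- Stated as membership in a submodule, so that the symmetry defect of `∇²` extends from pure
tensors by linearity; the integral itself is additive only on integrable functions. -/
theorem lapB_mul_sub_mem_integralZero (p q : MvPolynomial (Fin m) ℂ) :
    (∑ i : Fin m, bDeriv i * bDeriv i) (MvPolynomial.aeval coord p * gaussB m)
          * (MvPolynomial.aeval coord q * gaussB m)
        - MvPolynomial.aeval coord p * gaussB m
          * (∑ i : Fin m, bDeriv i * bDeriv i) (MvPolynomial.aeval coord q * gaussB m)
      ∈ integralZero m := by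
  simp only [LinearMap.sum_apply, Finset.sum_mul, Finset.mul_sum, ← Finset.sum_sub_distrib,
    Module.End.mul_apply]
  refine sum_mem fun i _ => ?_
  have hd := bDeriv_aeval_mul_gaussB i p
  have hd' := bDeriv_aeval_mul_gaussB i q
  have h1 : Integrable (bDeriv i (bDeriv i (MvPolynomial.aeval coord p * gaussB m))
      * (MvPolynomial.aeval coord q * gaussB m) : smooth m).1 := by
    rw [hd, bDeriv_aeval_mul_gaussB]
    exact integrable_of_mem_polyGaussSq (mul_mem_polyGaussSq _ _)
  have h2 : Integrable (MvPolynomial.aeval coord p * gaussB m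
      * bDeriv i (bDeriv i (MvPolynomial.aeval coord q * gaussB m)) : smooth m).1 := by
    rw [hd', bDeriv_aeval_mul_gaussB]
    exact integrable_of_mem_polyGaussSq (mul_mem_polyGaussSq _ _)
  refine ⟨h1.sub h2, (integral_sub h1 h2).trans (sub_eq_zero.2 ?_)⟩
  rw [hd, integral_bDeriv_mul, ← hd, hd', ← neg_eq_iff_eq_neg.2 (integral_bDeriv_mul i p _)]

/-! ### The superintegral -/

/-- The Berezin integral on superfunctions. -/
def superBerezin (m n : ℕ) : SuperFun m n →ₗ[ℂ] smooth m :=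
  (TensorProduct.rid ℂ (smooth m)).toLinearMap ∘ₗ LinearMap.lTensor (smooth m) (berezin n)

theorem superBerezin_tmul (f : smooth m) (a : Grassmann n) :
    superBerezin m n (f ⊗ₜ a) = berezin n a • f := by
  rw [superBerezin, LinearMap.comp_apply, LinearMap.lTensor_tmul]
  exact TensorProduct.rid_tmul _ _

theorem superInt_eq (f : SuperFun m n) : superInt f = ∫ x, (superBerezin m n f).1 x := rfl

theorem superBerezin_mul_mem {f g : SuperFun m n} (hf : f ∈ polyGauss m n)
    (hg : g ∈ polyGauss m n) : superBerezin m n (f * g) ∈ polyGaussSq m := by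
  obtain ⟨P, rfl⟩ := hf
  obtain ⟨Q, rfl⟩ := hg
  induction P using TensorProduct.induction_on with
  | zero => rw [map_zero, zero_mul, map_zero]; exact zero_mem _
  | add P P' hP hP' => rw [map_add, add_mul, map_add]; exact add_mem hP hP'
  | tmul p a =>
    induction Q using TensorProduct.induction_on with
    | zero => rw [map_zero, mul_zero, map_zero]; exact zero_mem _
    | add Q Q' hQ hQ' => rw [map_add, mul_add, map_add]; exact add_mem hQ hQ'
    | tmul q b =>
      rw [mulGauss_tmul, mulGauss_tmul, Algebra.TensorProduct.tmul_mul_tmul, superBerezin_tmul]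
      exact Submodule.smul_mem _ _ (mul_mem_polyGaussSq p q)

theorem integrable_superBerezin_mul {f g : SuperFun m n} (hf : f ∈ polyGauss m n)
    (hg : g ∈ polyGauss m n) : Integrable (superBerezin m n (f * g)).1 :=
  integrable_of_mem_polyGaussSq (superBerezin_mul_mem hf hg)

/-- On pure tensors the fermionic parts cancel pointwise under the Berezin integral, leaving a
multiple of the bosonic defect. -/
theorem superBerezin_lap_mul_sub_mem (P Q : SuperPoly m n) :
    superBerezin m n (lap m n (mulGauss m n P) * mulGauss m n Q
      - mulGauss m n P * lap m n (mulGauss m n Q)) ∈ integralZero m := by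
  induction P using TensorProduct.induction_on with
  | zero => simp only [map_zero, zero_mul, sub_zero]; exact zero_mem _
  | add P P' hP hP' =>
    have h := add_mem hP hP'
    rw [← map_add] at h
    rw [map_add, map_add, add_mul, add_mul]
    convert h using 2
    abel
  | tmul p a =>
    induction Q using TensorProduct.induction_on with
    | zero => simp only [map_zero, mul_zero, sub_zero]; exact zero_mem _
    | add Q Q' hQ hQ' =>
      have h := add_mem hQ hQ'
      rw [← map_add] at h
      rw [map_add, map_add, mul_add, mul_add]
      convert h using 2
      abel
    | tmul q b =>
      rw [mulGauss_tmul, mulGauss_tmul, lap, LinearMap.add_apply, LinearMap.add_apply,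
        LinearMap.rTensor_tmul, LinearMap.lTensor_tmul, LinearMap.rTensor_tmul,
        LinearMap.lTensor_tmul, add_mul, mul_add]
      simp only [Algebra.TensorProduct.tmul_mul_tmul]
      rw [map_sub, map_add, map_add]
      simp only [superBerezin_tmul]
      rw [berezin_lapF_mul, add_sub_add_right_eq_sub, ← smul_sub]
      exact Submodule.smul_mem _ _ (lapB_mul_sub_mem_integralZero p q)

theorem superInt_lap_mul {f g : SuperFun m n} (hf : f ∈ polyGauss m n) (hg : g ∈ polyGauss m n) :
    superInt (lap m n f * g) = superInt (f * lap m n g) := by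
  have h1 := integrable_superBerezin_mul (lap_mem hf) hg
  have h2 := integrable_superBerezin_mul hf (lap_mem hg)
  obtain ⟨P, rfl⟩ := hf
  obtain ⟨Q, rfl⟩ := hg
  have h := (superBerezin_lap_mul_sub_mem P Q).2
  rw [map_sub] at h
  exact sub_eq_zero.1 ((integral_sub h1 h2).symm.trans h)

end Gauss

section Adjoint

variable {m n : ℕ}

/-! ### The map `T` -/

/-- Multiplication by the Gaussian identifies `𝒫` with `𝒫 exp(-R²/2)`. -/
def polyGaussEquiv (m n : ℕ) : SuperPoly m n ≃ₗ[ℂ] polyGauss m n :=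
  LinearEquiv.ofInjective (mulGauss m n) mulGauss_injective

theorem isTwist_iff {T : polyGauss m n →ₗ[ℂ] polyGauss m n} :
    IsTwist m n T ↔ ∀ j i p q, i + q ≤ n → ∀ h ∈ harmonicB m p, ∀ w ∈ harmonicF n q,
      T (polyGaussEquiv m n (fischerElt j i p q h w))
        = polyGaussEquiv m n ((-1 : ℂ) ^ i • fischerElt j i p q h (tilde n w)) :=
  Iff.rfl

theorem IsTwist.apply_polyGaussEquiv (hM : 2 * n < m) {T : polyGauss m n →ₗ[ℂ] polyGauss m n}
    (hT : IsTwist m n T) {S : Module.End ℂ (SuperPoly m n)}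
    (hS : ∀ j i p q, i + q ≤ n → ∀ h ∈ harmonicB m p, ∀ w ∈ harmonicF n q,
      S (fischerElt j i p q h w) = (-1 : ℂ) ^ i • fischerElt j i p q h (tilde n w))
    (P : SuperPoly m n) :
    T (polyGaussEquiv m n P) = polyGaussEquiv m n (S P) := by
  have h : T ∘ₗ (polyGaussEquiv m n).toLinearMap = (polyGaussEquiv m n).toLinearMap ∘ₗ S := by
    refine linearMap_ext_fischerElt hM fun j i p q hi h hh w hw => ?_
    rw [LinearMap.comp_apply, LinearMap.comp_apply, hS j i p q hi h hh w hw]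
    exact isTwist_iff.1 hT j i p q hi h hh w hw
  exact congr($h P)

theorem existsUnique_isTwist (hM : 2 * n < m) :
    ∃! T : polyGauss m n →ₗ[ℂ] polyGauss m n, IsTwist m n T := by
  obtain ⟨S, hS⟩ := exists_polyTwist (m := m) (n := n) hM
  refine ⟨(polyGaussEquiv m n).conj S, ?_, ?_⟩
  · refine isTwist_iff.2 fun j i p q hi h hh w hw => ?_
    rw [LinearEquiv.conj_apply_apply, LinearEquiv.symm_apply_apply, hS j i p q hi h hh w hw]
  · intro T hT
    refine LinearMap.ext fun f => ?_
    obtain ⟨P, rfl⟩ := (polyGaussEquiv m n).surjective f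
    rw [hT.apply_polyGaussEquiv hM hS, LinearEquiv.conj_apply_apply, LinearEquiv.symm_apply_apply]

theorem isTwist_twist (hM : 2 * n < m) : IsTwist m n (twist m n) :=
  Classical.epsilon_spec (existsUnique_isTwist hM).exists

theorem twist_mulR2 (hM : 2 * n < m) (f : polyGauss m n) :
    (twist m n ⟨mulR2 m n f, mulR2_mem f.2⟩ : SuperFun m n) = mulR2 m n (twist m n f) := by
  obtain ⟨S, hS⟩ := exists_polyTwist (m := m) (n := n) hM
  obtain ⟨P, rfl⟩ := (polyGaussEquiv m n).surjective f
  have h : (⟨mulR2 m n (polyGaussEquiv m n P), mulR2_mem (polyGaussEquiv m n P).2⟩ :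
      polyGauss m n) = polyGaussEquiv m n (R2 m n * P) :=
    Subtype.ext (mulR2_mulGauss P)
  rw [h, (isTwist_twist hM).apply_polyGaussEquiv hM hS,
    (isTwist_twist hM).apply_polyGaussEquiv hM hS, polyTwist_R2_mul hM hS]
  exact (mulR2_mulGauss (S P)).symm

theorem twist_lap (hM : 2 * n < m) (f : polyGauss m n) :
    (twist m n ⟨lap m n f, lap_mem f.2⟩ : SuperFun m n) = lap m n (twist m n f) := by
  obtain ⟨S, hS⟩ := exists_polyTwist (m := m) (n := n) hM
  obtain ⟨P, rfl⟩ := (polyGaussEquiv m n).surjective f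
  have h : (⟨lap m n (polyGaussEquiv m n P), lap_mem (polyGaussEquiv m n P).2⟩ : polyGauss m n)
      = polyGaussEquiv m n (lapP m n P - (2 : ℂ) • weightP m n P + R2 m n * P) :=
    Subtype.ext (lap_mulGauss P)
  rw [h, (isTwist_twist hM).apply_polyGaussEquiv hM hS,
    (isTwist_twist hM).apply_polyGaussEquiv hM hS, map_add S, map_sub S, map_smul S,
    polyTwist_R2_mul hM hS, polyTwist_lapP hM hS, polyTwist_weightP hM hS]
  exact (lap_mulGauss (S P)).symm

/-! ### Sesquilinearity of the form -/

theorem superInt_add_mul {f f' g : SuperFun m n} (hf : f ∈ polyGauss m n) (hf' : f' ∈ polyGauss m n)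
    (hg : g ∈ polyGauss m n) : superInt ((f + f') * g) = superInt (f * g) + superInt (f' * g) := by
  rw [add_mul, superInt_eq, map_add]
  exact MeasureTheory.integral_add (integrable_superBerezin_mul hf hg)
    (integrable_superBerezin_mul hf' hg)

theorem superInt_mul_add {f g g' : SuperFun m n} (hf : f ∈ polyGauss m n) (hg : g ∈ polyGauss m n)
    (hg' : g' ∈ polyGauss m n) :
    superInt (f * (g + g')) = superInt (f * g) + superInt (f * g') := by
  rw [mul_add, superInt_eq, map_add]
  exact MeasureTheory.integral_add (integrable_superBerezin_mul hf hg)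
    (integrable_superBerezin_mul hf hg')

theorem superInt_smul (c : ℂ) (f : SuperFun m n) : superInt (c • f) = c * superInt f := by
  rw [superInt_eq, map_smul]
  exact MeasureTheory.integral_smul c _

theorem superConj_twist_mem (g : polyGauss m n) :
    superConj m n (twist m n g : SuperFun m n) ∈ polyGauss m n :=
  superConj_mem (twist m n g).2

theorem inner2_add_left (f f' g : polyGauss m n) :
    inner2 (f + f') g = inner2 f g + inner2 f' g :=
  superInt_add_mul f.2 f'.2 (superConj_twist_mem g)

theorem inner2_add_right (f g g' : polyGauss m n) :
    inner2 f (g + g') = inner2 f g + inner2 f g' := by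
  rw [inner2, map_add, Submodule.coe_add, map_add]
  exact superInt_mul_add f.2 (superConj_twist_mem g) (superConj_twist_mem g')

theorem inner2_smul_left (c : ℂ) (f g : polyGauss m n) : inner2 (c • f) g = c * inner2 f g := by
  rw [inner2, Submodule.coe_smul, smul_mul_assoc, superInt_smul]
  rfl

theorem inner2_smul_right (c : ℂ) (f g : polyGauss m n) :
    inner2 f (c • g) = starRingEnd ℂ c * inner2 f g := by
  rw [inner2, map_smul, Submodule.coe_smul, map_smulₛₗ, mul_smul_comm, superInt_smul]
  rfl

/-! ### Adjoints -/

namespace IsAdjoint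

variable {A A' B B' : Module.End ℂ (SuperFun m n)}

theorem add (h : IsAdjoint A B) (h' : IsAdjoint A' B') : IsAdjoint (A + A') (B + B') := by
  obtain ⟨hA, hB, hAB⟩ := h
  obtain ⟨hA', hB', hAB'⟩ := h'
  refine ⟨fun f hf => add_mem (hA f hf) (hA' f hf), fun f hf => add_mem (hB f hf) (hB' f hf),
    fun f g => ?_⟩
  have e := congrArg₂ (· + ·) (hAB f g) (hAB' f g)
  simp only [← inner2_add_left, ← inner2_add_right] at e
  exact e

/-- A scalar leaves the second argument conjugated; this is where the coefficients of `V` have to be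
real. -/
theorem smul (h : IsAdjoint A B) {c : ℂ} (hc : starRingEnd ℂ c = c) :
    IsAdjoint (c • A) (c • B) := by
  obtain ⟨hA, hB, hAB⟩ := h
  refine ⟨fun f hf => Submodule.smul_mem _ _ (hA f hf), fun f hf => Submodule.smul_mem _ _ (hB f hf),
    fun f g => ?_⟩
  have e : c * inner2 (A.restrict hA f) g = starRingEnd ℂ c * inner2 f (B.restrict hB g) := by
    rw [hc, hAB f g]
  rw [← inner2_smul_left, ← inner2_smul_right] at e
  exact e

theorem mul (h : IsAdjoint A B) (h' : IsAdjoint A' B') : IsAdjoint (A * A') (B' * B) := by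
  obtain ⟨hA, hB, hAB⟩ := h
  obtain ⟨hA', hB', hAB'⟩ := h'
  exact ⟨fun f hf => hA _ (hA' f hf), fun f hf => hB' _ (hB f hf),
    fun f g => (hAB (A'.restrict hA' f) g).trans (hAB' f (B.restrict hB g))⟩

theorem one : IsAdjoint (1 : Module.End ℂ (SuperFun m n)) 1 :=
  ⟨fun _ hf => hf, fun _ hf => hf, fun _ _ => rfl⟩

theorem pow (h : IsAdjoint A A) (k : ℕ) : IsAdjoint (A ^ k) (A ^ k) := by
  induction k with
  | zero => exact one
  | succ k ih =>
    have := ih.mul h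
    rwa [← pow_succ, ← pow_succ'] at this

theorem aeval_map (h : IsAdjoint A A) (V : Polynomial ℝ) :
    IsAdjoint (Polynomial.aeval A (V.map (algebraMap ℝ ℂ)))
      (Polynomial.aeval A (V.map (algebraMap ℝ ℂ))) := by
  induction V using Polynomial.induction_on' with
  | add V W hV hW =>
    rw [Polynomial.map_add, map_add]
    exact hV.add hW
  | monomial k c =>
    rw [Polynomial.map_monomial, Polynomial.aeval_monomial, ← Algebra.smul_def]
    exact (h.pow k).smul (Complex.conj_ofReal c)

end IsAdjoint

theorem isAdjoint_mulR2 (hM : 2 * n < m) : IsAdjoint (mulR2 m n) (mulR2 m n) := by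
  refine ⟨fun f hf => mulR2_mem hf, fun f hf => mulR2_mem hf, fun f g => ?_⟩
  have h : (twist m n ((mulR2 m n).restrict (fun f hf => mulR2_mem hf) g) : SuperFun m n)
      = mulR2 m n (twist m n g) := twist_mulR2 hM g
  rw [inner2, inner2, h, superConj_mulR2, ← mulR2_mul]
  rfl

theorem isAdjoint_lap (hM : 2 * n < m) : IsAdjoint (lap m n) (lap m n) := by
  refine ⟨fun f hf => lap_mem hf, fun f hf => lap_mem hf, fun f g => ?_⟩
  have h : (twist m n ((lap m n).restrict (fun f hf => lap_mem hf) g) : SuperFun m n)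
      = lap m n (twist m n g) := twist_lap hM g
  rw [inner2, inner2, h, superConj_lap]
  exact superInt_lap_mul f.2 (superConj_twist_mem g)

/-- Taking adjoints reverses products, so a commutator of two symmetric operators changes sign. -/
theorem isAdjoint_eulerShift (hM : 2 * n < m) :
    IsAdjoint (eulerShift m n) (-eulerShift m n) := by
  have h1 := (isAdjoint_lap hM).mul (isAdjoint_mulR2 hM)
  have h2 := ((isAdjoint_mulR2 hM).mul (isAdjoint_lap hM)).smul (c := -1) (by simp)
  have h := (h1.add h2).smul (c := 1 / 2) (by simp [Complex.conj_ofNat])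
  have e : -eulerShift m n
      = (1 / 2 : ℂ) • (mulR2 m n * lap m n + (-1 : ℂ) • (lap m n * mulR2 m n)) := by
    rw [eulerShift_eq_commutator]
    module
  rwa [← eulerShift_eq_commutator, ← e] at h

theorem isAdjoint_schrodinger (hM : 2 * n < m) (V : Polynomial ℝ) :
    IsAdjoint (schrodinger m n V) (schrodinger m n V) :=
  ((isAdjoint_lap hM).smul (by simp [Complex.conj_ofNat])).add ((isAdjoint_mulR2 hM).aeval_map V)

end Adjoint

end SuperSpace

end

/-! ### The theorem. -/

theorem mainTheorem7 (m n : ℕ) (hM : 0 < SuperSpace.superDim m n) :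
    (∃! T : SuperSpace.polyGauss m n →ₗ[ℂ] SuperSpace.polyGauss m n, SuperSpace.IsTwist m n T) ∧
    SuperSpace.IsAdjoint (SuperSpace.mulR2 m n) (SuperSpace.mulR2 m n) ∧
    SuperSpace.IsAdjoint (SuperSpace.lap m n) (SuperSpace.lap m n) ∧
    SuperSpace.IsAdjoint (SuperSpace.eulerShift m n) (-SuperSpace.eulerShift m n) ∧
    ∀ V : Polynomial ℝ,
      SuperSpace.IsAdjoint (SuperSpace.schrodinger m n V) (SuperSpace.schrodinger m n V) := by
  have hM' : 2 * n < m := by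
    rw [SuperSpace.superDim] at hM
    omega
  exact ⟨SuperSpace.existsUnique_isTwist hM', SuperSpace.isAdjoint_mulR2 hM',
    SuperSpace.isAdjoint_lap hM', SuperSpace.isAdjoint_eulerShift hM',
    SuperSpace.isAdjoint_schrodinger hM'⟩
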